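/- **Setting.** Let $X,Z$ be random vectors in $\mathbb R^d$ on a common probability space, with supports $\mathcal Z\subset\mathcal X\subset\mathbb R^d$, let $m\ge1$ and let $\phi:\mathcal X\to\mathbb R^m$ be measurable. Assume that the laws $\nu_0$ of $\phi(X)$ and $\nu_1$ of $\phi(Z)$ have Lebesgue densities $f_0,f_1\ge 0$ on $\mathbb R^m$ and that $\nu_1\ll\nu_0$; put $r=f_1/f_0$ (with $0/0=0$). Let $X_1,X_2,\dots$ be copies of $X$ and $Z_1,Z_2,\dots$ copies of $Z$, all mutually independent. The sample sizes are $N_0$ and $N_1=N_1(N_0)$, the number of matches is $M=M(N_0)$, and all limits are as $N_0\to\infty$. For $x\in\mathcal X$ let $\hat\phi$ be an estimator of $\phi$ which may depend (measurably) on $X_1,\dots,X_{N_0},Z_1,\dots,Z_{N_1}$, and also on $x$. Let $\hat\Phi_M(z)$ be the $M$-th order statistic of $\{\|\hat\phi(X_i)-\hat\phi(z)\|\}_{i=1}^{N_0}$ and set $$A_\phi(x)=\{z\in\mathcal Z:\|\hat\phi(x)-\hat\phi(z)\|\le\hat\Phi_M(z)\},\quad K_\phi(x)=\sum_{j=1}^{N_1}\mathbf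 1(Z_j\in A_\phi(x)),\quad \hat r_\phi(x)=\frac{N_0}{N_1}\frac{K_\phi(x)}{M}.$$ For a positive integer $p$ and $z\in\mathcal Z^p$ let $\hat\phi_{(Z_1,\dots,Z_p)\to z}$ be the estimator computed with $(Z_1,\dots,Z_p)$ replaced by $z$, and let $\|\cdot\|_\infty$ be the supremum over $\mathcal X$ of the Euclidean norm. Consider the following two conditions. (A) For some integer $1\le q\le m$, $$\lim_{N_0\to\infty}\mathrm E\Big[\Big(\frac{N_0}{M}\Big)^p\sup_{z\in\mathcal Z^p}\|\hat\phi_{(Z_1,\dots,Z_p)\to z}-\phi\|_\infty^{pq}\Big]=0.$$ (B) For every $\epsilon>0$ there are functions $T_\epsilon=T_{\epsilon,N_0}:(0,\infty)\to[0,\infty]$ such that, for all $N_0$ and all $u>0$, $$\mathrm P\Big(\sup_{\delta\ge u}\delta^{-1}\sup_{s,t\in\mathcal X:\|\phi(s)-\phi(t)\|\le\delta}\ \sup_{z\in\mathcal Z^p}\big\|(\hat\phi_{(Z_1,\dots,Z_p)\to z}-\phi)(s)-(\hat\phi_{(Z_1,\dots,Z_p)\to z}-\phi)(t)\big\|>\epsilon\Big)\le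 T_{\epsilon}(u),$$ for every $k\in\{1,\dots,p\}$, $\lim_{N_0\to\infty}(N_0/M)^k\int_0^\infty u^{k-1}T_\epsilon(u^{1/m})\,du=0$, and $\lim_{N_0\to\infty}(N_0/M)^p\,\mathrm P(\|\hat\phi-\phi\|_\infty>\epsilon)=0$. **Corollary (pointwise consistency).** Let $p$ be an even positive integer and assume that $M\log N_0/N_0\to0$, $MN_1/N_0\to\infty$ and $M\to\infty$ as $N_0\to\infty$. Then for every $x\in\mathcal X$ for which (A) or (B) holds, $f_0(\phi(x))>0$, and $f_0,f_1$ are continuous at $\phi(x)$ (as functions on $\mathbb R^m$), the random variable $|\hat r_\phi(x)-r(\phi(x))|^p$ is integrable for every $N_0$ and $$\lim_{N_0\to\infty}\mathrm E\big[|\hat r_\phi(x)-r(\phi(x))|^p\big]=0 .$$ -/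

import Mathlib

open MeasureTheory ProbabilityTheory Filter Topology
open scoped ENNReal

noncomputable section

namespace DensityRatio

/-- `ℝᵈ` with the Euclidean norm. -/
abbrev E (d : ℕ) : Type := EuclideanSpace ℝ (Fin d)

/-- The `M`-th order statistic (the `M`-th smallest value, `1 ≤ M ≤ n`) of `a 0, …, a (n - 1)`;
the value outside of `1 ≤ M ≤ n` is irrelevant. -/
def orderStat {n : ℕ} (M : ℕ) (a : Fin n → ℝ) : ℝ :=
  if h : M - 1 < n then a (Tuple.sort a ⟨M - 1, h⟩) else 0

/-- The catchment area of `x`: the points `z` of `𝒵` such that `‖g x - g z‖` is at most the `M`-th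
order statistic of `‖g X₁ - g z‖, …, ‖g Xₙ - g z‖`. Here `g` is the (estimated) transformation. -/
def catchment {d m n : ℕ} (𝒵 : Set (E d)) (M : ℕ) (xs : Fin n → E d) (g : E d → E m) (x : E d) :
    Set (E d) :=
  {z ∈ 𝒵 | ‖g x - g z‖ ≤ orderStat M (fun i => ‖g (xs i) - g z‖)}

/-- The number of matched times of `x`: the number of the `Z_j` in the catchment area of `x`. -/
def matchCount {d m n k : ℕ} (𝒵 : Set (E d)) (M : ℕ) (xs : Fin n → E d) (zs : Fin k → E d)
    (g : E d → E m) (x : E d) : ℝ :=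
  ∑ j, (catchment 𝒵 M xs g x).indicator (fun _ => (1 : ℝ)) (zs j)

/-- The density ratio estimator `(N₀ / N₁) * (K(x) / M)` for the transformation `g`. -/
def ratioEstimate {d m n k : ℕ} (𝒵 : Set (E d)) (M : ℕ) (xs : Fin n → E d) (zs : Fin k → E d)
    (g : E d → E m) (x : E d) : ℝ :=
  ((n : ℝ) / (k : ℝ)) * (matchCount 𝒵 M xs zs g x / (M : ℝ))

/-- An estimator of a transformation `ℝᵈ → ℝᵐ` from the samples `X₁, …, X_n`, `Z₁, …, Z_k`
and the evaluation point `x`. -/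
abbrev TransformEstimator (d m n k : ℕ) : Type :=
  (Fin n → E d) → (Fin k → E d) → E d → E d → E m

/-- The sample `zs` with its first `p` members replaced by `z`. -/
def replaceFirst {d k : ℕ} (p : ℕ) (zs : Fin k → E d) (z : Fin p → E d) : Fin k → E d :=
  fun j => if h : (j : ℕ) < p then z ⟨j, h⟩ else zs j

/-- The sup norm of `g - φ` over `𝒳`, as an extended nonnegative number. -/
def supDist {d m : ℕ} (𝒳 : Set (E d)) (g φ : E d → E m) : ℝ≥0∞ :=
  ⨆ t ∈ 𝒳, ‖g t - φ t‖ₑ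

/-- `sup_{z ∈ 𝒵ᵖ} ‖φ̂_{(Z₁,…,Z_p) → z} - φ‖_∞ ^ r`. -/
def replacedSupPow {d m n k : ℕ} (𝒳 𝒵 : Set (E d)) (φ : E d → E m)
    (φhat : TransformEstimator d m n k) (x : E d) (p r : ℕ)
    (xs : Fin n → E d) (zs : Fin k → E d) : ℝ≥0∞ :=
  ⨆ z ∈ {z : Fin p → E d | ∀ i, z i ∈ 𝒵},
    supDist 𝒳 (φhat xs (replaceFirst p zs z) x) φ ^ r

/-- `sup_{δ ≥ u} δ⁻¹ sup_{s, t ∈ 𝒳, ‖φ s - φ t‖ ≤ δ} sup_{z ∈ 𝒵ᵖ}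
‖(φ̂_{(Z₁,…,Z_p) → z} - φ)(s) - (φ̂_{(Z₁,…,Z_p) → z} - φ)(t)‖`. -/
def replacedModulus {d m n k : ℕ} (𝒳 𝒵 : Set (E d)) (φ : E d → E m)
    (φhat : TransformEstimator d m n k) (x : E d) (p : ℕ) (u : ℝ)
    (xs : Fin n → E d) (zs : Fin k → E d) : ℝ≥0∞ :=
  ⨆ (δ : ℝ) (_ : u ≤ δ), ENNReal.ofReal δ⁻¹ *
    ⨆ (s ∈ 𝒳) (t ∈ 𝒳) (_ : ‖φ s - φ t‖ ≤ δ) (z ∈ {z : Fin p → E d | ∀ i, z i ∈ 𝒵}),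
      ‖(φhat xs (replaceFirst p zs z) x s - φ s) - (φhat xs (replaceFirst p zs z) x t - φ t)‖ₑ

section Sampling

variable {Ω : Type*} [MeasurableSpace Ω]

/-- The sample `(X₁, …, X_N), (Z₁, …, Z_k)`. -/
def sample {d : ℕ} (X Z : ℕ → Ω → E d) (N k : ℕ) (ω : Ω) : (Fin N → E d) × (Fin k → E d) :=
  (fun i => X i ω, fun j => Z j ω)

/-- The sup-norm approximation condition for the estimators `φ̂_N` used at the point `x`:
`E[(N₀/M)ᵖ sup_{z ∈ 𝒵ᵖ} ‖φ̂_{(Z₁,…,Z_p) → z} - φ‖_∞ ^ (p q)] → 0` for some `q ∈ {1, …, m}`.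
The first clause says that the random variable under the expectation is measurable with
respect to the completed law of the sample. -/
def SupNormCondition {d m : ℕ} (P : Measure Ω) (X Z : ℕ → Ω → E d) (M N₁ : ℕ → ℕ)
    (𝒳 𝒵 : Set (E d)) (φ : E d → E m) (φhat : ∀ N : ℕ, TransformEstimator d m N (N₁ N))
    (p : ℕ) (x : E d) : Prop :=
  ∃ q : ℕ, 1 ≤ q ∧ q ≤ m ∧
    (∀ N, AEMeasurable
      (fun s : (Fin N → E d) × (Fin (N₁ N) → E d) =>
        replacedSupPow 𝒳 𝒵 φ (φhat N) x p (p * q) s.1 s.2)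
      (P.map (sample X Z N (N₁ N)))) ∧
    Tendsto (fun N : ℕ => ∫⁻ ω, ((N : ℝ≥0∞) / (M N : ℝ≥0∞)) ^ p *
        replacedSupPow 𝒳 𝒵 φ (φhat N) x p (p * q)
          (sample X Z N (N₁ N) ω).1 (sample X Z N (N₁ N) ω).2 ∂P)
      atTop (𝓝 0)

/-- The modulus-of-continuity approximation condition for the estimators `φ̂_N` used at the
point `x`. The bound `T` may depend on `ε` and on the sample size. The first clause says that the
random variables whose probabilities are taken are measurable with respect to the completed law
of the sample. -/
def ModulusCondition {d m : ℕ} (P : Measure Ω) (X Z : ℕ → Ω → E d) (M N₁ : ℕ → ℕ)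
    (𝒳 𝒵 : Set (E d)) (φ : E d → E m) (φhat : ∀ N : ℕ, TransformEstimator d m N (N₁ N))
    (p : ℕ) (x : E d) : Prop :=
  (∀ N, (∀ u : ℝ, 0 < u → AEMeasurable
        (fun s : (Fin N → E d) × (Fin (N₁ N) → E d) =>
          replacedModulus 𝒳 𝒵 φ (φhat N) x p u s.1 s.2)
        (P.map (sample X Z N (N₁ N)))) ∧
      AEMeasurable
        (fun s : (Fin N → E d) × (Fin (N₁ N) → E d) => supDist 𝒳 (φhat N s.1 s.2 x) φ)
        (P.map (sample X Z N (N₁ N)))) ∧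
  ∀ ε : ℝ, 0 < ε → ∃ T : ℕ → ℝ → ℝ≥0∞,
    (∀ N : ℕ, ∀ u : ℝ, 0 < u →
      P {ω | ENNReal.ofReal ε < replacedModulus 𝒳 𝒵 φ (φhat N) x p u
        (sample X Z N (N₁ N) ω).1 (sample X Z N (N₁ N) ω).2} ≤ T N u) ∧
    (∀ k : ℕ, 1 ≤ k → k ≤ p →
      Tendsto (fun N : ℕ => ((N : ℝ≥0∞) / (M N : ℝ≥0∞)) ^ k *
          ∫⁻ u in Set.Ioi (0 : ℝ), ENNReal.ofReal (u ^ (k - 1)) * T N (u ^ (1 / (m : ℝ))))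
        atTop (𝓝 0)) ∧
    Tendsto (fun N : ℕ => ((N : ℝ≥0∞) / (M N : ℝ≥0∞)) ^ p *
        P {ω | ENNReal.ofReal ε < supDist 𝒳
          (φhat N (sample X Z N (N₁ N) ω).1 (sample X Z N (N₁ N) ω).2 x) φ})
      atTop (𝓝 0)

end Sampling

end DensityRatio

end

/-!
Fix `x`, and let `ρ` be the radius at which a ball around `φ x` is expected to contain `M` of the
`N₀` points `φ (Xᵢ)`, whose density there is about `f₀ (φ x) > 0`. A point `z` is matched to `x` if
and only if fewer than `M` of the `Xᵢ` are strictly closer to `z` than `x` is. If the features were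
known, then by Chernoff bounds for binomial variables this would, up to negligible probability,
happen for `‖φ z - φ x‖ < ρ / s` and fail for `‖φ z - φ x‖ > s ρ`, for any `s > 1`. Hence `r̂ x` is
close to `N₀ / (N₁ M)` times the number of `Zⱼ` with `φ (Zⱼ)` in the ball of radius `ρ`, and its
mean tends to `f₁ (φ x) / f₀ (φ x)` by continuity of the densities.

Replacing `φ` by its estimate changes the radius only by a factor close to `1`, as long as the
increments of the error are small relative to the distance. The conditions (A) and (B) say that this
can only fail when the sup error is large, or below a random scale `D`, and they bound the
probability of the former and the `Lᵖ` size of `Dᵐ`. As `D` may depend on the `Zⱼ`, the number of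
`Zⱼ` below scale `D` is bounded at all dyadic scales simultaneously, by about `N₁ Dᵐ`. Both
contributions then vanish in `Lᵖ`.
-/

namespace DensityRatio

section VanishesInLp

variable {Ω : ℕ → Type*} [∀ N, MeasurableSpace (Ω N)] {P : ∀ N, Measure (Ω N)} {p : ℕ}
  {F G : ∀ N, Ω N → ℝ≥0∞}

/-- Convergence to `0` in `Lᵖ` of a sequence of nonnegative random variables, each on its own
probability space. The values are in `ℝ≥0∞`, so that no integrability has to be tracked. -/
def VanishesInLp (P : ∀ N, Measure (Ω N)) (p : ℕ) (F : ∀ N, Ω N → ℝ≥0∞) : Prop :=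
  (∀ N, AEMeasurable (F N) (P N)) ∧ Tendsto (fun N => ∫⁻ ω, F N ω ^ p ∂P N) atTop (𝓝 0)

lemma lintegral_add_pow_le {α : Type*} [MeasurableSpace α] {μ : Measure α} {f g : α → ℝ≥0∞}
    (hf : AEMeasurable f μ) (p : ℕ) :
    ∫⁻ a, (f a + g a) ^ p ∂μ ≤ 2 ^ p * (∫⁻ a, f a ^ p ∂μ + ∫⁻ a, g a ^ p ∂μ) := by
  rw [← lintegral_add_left' (hf.pow_const p), ← lintegral_const_mul' _ _ (by finiteness)]
  refine lintegral_mono fun a => ?_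
  calc (f a + g a) ^ p ≤ (2 * max (f a) (g a)) ^ p := by
        rw [two_mul]
        exact pow_le_pow_left₀ zero_le (add_le_add (le_max_left _ _) (le_max_right _ _)) p
    _ = 2 ^ p * max (f a) (g a) ^ p := mul_pow _ _ _
    _ ≤ 2 ^ p * (f a ^ p + g a ^ p) := by
        gcongr
        rcases max_cases (f a) (g a) with ⟨h, -⟩ | ⟨h, -⟩ <;> rw [h] <;> simp

namespace VanishesInLp

lemma mono (hG : VanishesInLp P p G) (hF : ∀ N, AEMeasurable (F N) (P N))
    (h : ∀ᶠ N in atTop, ∀ᵐ ω ∂P N, F N ω ≤ G N ω) : VanishesInLp P p F := by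
  refine ⟨hF, tendsto_of_tendsto_of_tendsto_of_le_of_le' tendsto_const_nhds hG.2
    (Eventually.of_forall fun _ => zero_le) (h.mono fun N hN => lintegral_mono_ae ?_)⟩
  filter_upwards [hN] with ω hω
  exact pow_le_pow_left₀ zero_le hω p

lemma add (hF : VanishesInLp P p F) (hG : VanishesInLp P p G) :
    VanishesInLp P p fun N ω => F N ω + G N ω := by
  refine ⟨fun N => (hF.1 N).add (hG.1 N), ?_⟩
  have hlim := ENNReal.Tendsto.const_mul (hF.2.add hG.2)
    (Or.inr (by finiteness : (2 : ℝ≥0∞) ^ p ≠ ∞))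
  rw [add_zero, mul_zero] at hlim
  exact tendsto_of_tendsto_of_tendsto_of_le_of_le tendsto_const_nhds hlim (fun _ => zero_le)
    fun N => lintegral_add_pow_le (hF.1 N) p

lemma const_mul (hF : VanishesInLp P p F) {c : ℝ≥0∞} (hc : c ≠ ∞) :
    VanishesInLp P p fun N ω => c * F N ω := by
  refine ⟨fun N => (hF.1 N).const_mul c, ?_⟩
  have hlim := ENNReal.Tendsto.const_mul hF.2 (Or.inr (ENNReal.pow_ne_top hc : c ^ p ≠ ∞))
  rw [mul_zero] at hlim
  refine hlim.congr fun N => ?_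
  simp_rw [mul_pow]
  rw [lintegral_const_mul' _ _ (ENNReal.pow_ne_top hc)]

lemma comp_measurePreserving {Ω' : ℕ → Type*} [∀ N, MeasurableSpace (Ω' N)]
    {P' : ∀ N, Measure (Ω' N)} (hF : VanishesInLp P p F) {T : ∀ N, Ω' N → Ω N}
    (hT : ∀ N, MeasurePreserving (T N) (P' N) (P N)) :
    VanishesInLp P' p fun N ω => F N (T N ω) := by
  refine ⟨fun N => (hF.1 N).comp_quasiMeasurePreserving (hT N).quasiMeasurePreserving,
    hF.2.congr fun N => ?_⟩
  rw [← (hT N).map_eq, lintegral_map' ?_ (hT N).aemeasurable]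
  rw [(hT N).map_eq]
  exact (hF.1 N).pow_const p

lemma of_tendsto [∀ N, IsProbabilityMeasure (P N)] (hp : p ≠ 0) {a : ℕ → ℝ≥0∞}
    (ha : Tendsto a atTop (𝓝 0)) : VanishesInLp P p fun N _ => a N := by
  refine ⟨fun N => aemeasurable_const, ?_⟩
  simpa [hp, Function.comp_def] using ((ENNReal.continuous_pow p).tendsto 0).comp ha

end VanishesInLp

lemma tendsto_lintegral_pow_of_forall_le_add [∀ N, IsProbabilityMeasure (P N)] (hp : p ≠ 0)
    (h : ∀ η : ℝ≥0∞, 0 < η → ∃ G : ∀ N, Ω N → ℝ≥0∞, VanishesInLp P p G ∧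
      ∀ᶠ N in atTop, ∀ᵐ ω ∂P N, F N ω ≤ G N ω + η) :
    Tendsto (fun N => ∫⁻ ω, F N ω ^ p ∂P N) atTop (𝓝 0) := by
  have hzero : Tendsto (fun η : ℝ≥0∞ => 2 ^ p * (0 + η ^ p)) (𝓝[>] 0) (𝓝 0) := by
    have hcont : Continuous fun η : ℝ≥0∞ => (2 : ℝ≥0∞) ^ p * (0 + η ^ p) :=
      (ENNReal.continuous_const_mul (by finiteness)).comp
        (continuous_const.add (ENNReal.continuous_pow p))
    simpa [hp] using (hcont.tendsto 0).mono_left nhdsWithin_le_nhds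
  refine tendsto_order.2 ⟨fun a ha => absurd ha not_lt_zero, fun a ha => ?_⟩
  obtain ⟨η, hη, hη0⟩ := ((hzero.eventually_lt_const ha).and self_mem_nhdsWithin).exists
  obtain ⟨G, hG, hFG⟩ := h η hη0
  have hbound := ENNReal.Tendsto.const_mul (hG.2.add_const (η ^ p))
    (Or.inr (by finiteness : (2 : ℝ≥0∞) ^ p ≠ ∞))
  filter_upwards [hFG, hbound.eventually_lt_const hη] with N hN hlt
  calc ∫⁻ ω, F N ω ^ p ∂P N ≤ ∫⁻ ω, (G N ω + η) ^ p ∂P N :=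
        lintegral_mono_ae (hN.mono fun ω hω => pow_le_pow_left₀ zero_le hω p)
    _ ≤ 2 ^ p * (∫⁻ ω, G N ω ^ p ∂P N + ∫⁻ _, η ^ p ∂P N) := lintegral_add_pow_le (hG.1 N) p
    _ < a := by simpa using hlt

end VanishesInLp

section Binomial

variable {α ι : Type*} [Fintype ι]

/-- The number of coordinates of `y` that lie in `G`. Under the product of copies of `ν` it is a
binomial random variable with mean `card ι * ν G`. -/
noncomputable def hits (G : Set α) (y : ι → α) : ℝ :=
  ∑ j, G.indicator (fun _ => (1 : ℝ)) (y j)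

lemma hits_nonneg (G : Set α) (y : ι → α) : 0 ≤ hits G y :=
  Finset.sum_nonneg fun _ _ => Set.indicator_nonneg (fun _ _ => zero_le_one) _

lemma hits_le_card (G : Set α) (y : ι → α) : hits G y ≤ Fintype.card ι := by
  have : hits G y ≤ ∑ _j : ι, (1 : ℝ) :=
    Finset.sum_le_sum fun _ _ => Set.indicator_le_self' (fun _ _ => zero_le_one) _
  simpa using this

lemma hits_eq_card_filter (G : Set α) [DecidablePred (· ∈ G)] (y : ι → α) :
    hits G y = (Finset.univ.filter fun j => y j ∈ G).card := by
  simp only [hits, Set.indicator_apply, Finset.sum_boole]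

lemma hits_le_hits {β : Type*} {G : Set α} {H : Set β} {y : ι → α} {w : ι → β}
    (h : ∀ j, y j ∈ G → w j ∈ H) : hits G y ≤ hits H w := by
  classical
  rw [hits_eq_card_filter, hits_eq_card_filter]
  exact_mod_cast Finset.card_le_card (Finset.monotone_filter_right _ fun j _ => h j)

lemma hits_union_le (G H : Set α) (y : ι → α) : hits (G ∪ H) y ≤ hits G y + hits H y := by
  classical
  rw [hits_eq_card_filter, hits_eq_card_filter, hits_eq_card_filter]
  simp only [Set.mem_union, Finset.filter_or]
  exact_mod_cast Finset.card_union_le _ _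

variable [MeasurableSpace α]

lemma measurable_hits {G : Set α} (hG : MeasurableSet G) :
    Measurable (hits G : (ι → α) → ℝ) :=
  Finset.measurable_sum _ fun j _ =>
    (measurable_const.indicator hG).comp (measurable_pi_apply j)

variable (ν : Measure α) [IsProbabilityMeasure ν] {G : Set α}

lemma lintegral_exp_mul_indicator (hG : MeasurableSet G) (t : ℝ) :
    ∫⁻ a, ENNReal.ofReal (Real.exp (t * G.indicator (fun _ => (1 : ℝ)) a)) ∂ν
      = ENNReal.ofReal (1 + ν.real G * (Real.exp t - 1)) := by
  have hpt : ∀ a, ENNReal.ofReal (Real.exp (t * G.indicator (fun _ => (1 : ℝ)) a))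
      = G.indicator (fun _ => ENNReal.ofReal (Real.exp t)) a + Gᶜ.indicator (fun _ => 1) a := by
    intro a
    by_cases h : a ∈ G <;> simp [h]
  simp_rw [hpt]
  rw [lintegral_add_left (measurable_const.indicator hG), lintegral_indicator_const hG,
    lintegral_indicator_const hG.compl, one_mul, ← ofReal_measureReal, ← ofReal_measureReal,
    probReal_compl_eq_one_sub hG, ← ENNReal.ofReal_mul (Real.exp_pos t).le,
    ← ENNReal.ofReal_add (by positivity) (sub_nonneg.2 measureReal_le_one)]
  ring_nf

lemma lintegral_exp_mul_hits_sub_le (hG : MeasurableSet G) (t c : ℝ) :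
    ∫⁻ y : ι → α, ENNReal.ofReal (Real.exp (t * (hits G y - c))) ∂(Measure.pi fun _ => ν)
      ≤ ENNReal.ofReal
          (Real.exp (Fintype.card ι * ν.real G * (Real.exp t - 1) - t * c)) := by
  have hpt : ∀ y : ι → α, ENNReal.ofReal (Real.exp (t * (hits G y - c)))
      = ENNReal.ofReal (Real.exp (-(t * c))) *
        ∏ j, ENNReal.ofReal (Real.exp (t * G.indicator (fun _ => (1 : ℝ)) (y j))) := by
    intro y
    rw [← ENNReal.ofReal_prod_of_nonneg fun _ _ => (Real.exp_pos _).le, ← Real.exp_sum,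
      ← Finset.mul_sum, ← ENNReal.ofReal_mul (Real.exp_pos _).le, ← Real.exp_add, hits]
    ring_nf
  have hmeas : Measurable fun a =>
      ENNReal.ofReal (Real.exp (t * G.indicator (fun _ => (1 : ℝ)) a)) :=
    (Real.measurable_exp.comp ((measurable_const.indicator hG).const_mul t)).ennreal_ofReal
  have hcoord : ∀ j : ι, ∫⁻ y : ι → α, ENNReal.ofReal
      (Real.exp (t * G.indicator (fun _ => (1 : ℝ)) (y j))) ∂(Measure.pi fun _ => ν)
        = ENNReal.ofReal (1 + ν.real G * (Real.exp t - 1)) := fun j =>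
    ((measurePreserving_eval (fun _ : ι => ν) j).lintegral_comp hmeas).trans
      (lintegral_exp_mul_indicator ν hG t)
  simp_rw [hpt]
  rw [lintegral_const_mul' _ _ ENNReal.ofReal_ne_top,
    lintegral_prod_eq_prod_lintegral_of_indepFun _ _ (iIndepFun_pi fun _ => hmeas.aemeasurable)
      fun j => hmeas.comp (measurable_pi_apply j)]
  simp only [hcoord, Finset.prod_const, Finset.card_univ]
  calc ENNReal.ofReal (Real.exp (-(t * c))) *
        ENNReal.ofReal (1 + ν.real G * (Real.exp t - 1)) ^ Fintype.card ι
      ≤ ENNReal.ofReal (Real.exp (-(t * c))) *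
        ENNReal.ofReal (Real.exp (ν.real G * (Real.exp t - 1))) ^ Fintype.card ι := by
        gcongr
        linarith [Real.add_one_le_exp (ν.real G * (Real.exp t - 1))]
    _ = _ := by
        rw [← ENNReal.ofReal_pow (Real.exp_pos _).le, ← Real.exp_nat_mul,
          ← ENNReal.ofReal_mul (Real.exp_pos _).le, ← Real.exp_add]
        ring_nf

end Binomial

section ExponentialMoments

variable {Ω : Type*} [MeasurableSpace Ω] (P : Measure Ω)

lemma ofReal_pow_le_exp {s : ℝ} (hs : 0 < s) {p : ℕ} (hp : p ≠ 0) (x : ℝ) :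
    ENNReal.ofReal x ^ p
      ≤ ENNReal.ofReal (p.factorial * s⁻¹ ^ p) * ENNReal.ofReal (Real.exp (s * x)) := by
  rcases le_total x 0 with hx | hx
  · rw [ENNReal.ofReal_of_nonpos hx, zero_pow hp]
    exact zero_le
  rw [← ENNReal.ofReal_pow hx, ← ENNReal.ofReal_mul (by positivity)]
  refine ENNReal.ofReal_le_ofReal ?_
  have h := Real.pow_div_factorial_le_exp (s * x) (by positivity) p
  rw [div_le_iff₀ (by positivity), mul_pow] at h
  calc x ^ p = s⁻¹ ^ p * (s ^ p * x ^ p) := by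
        rw [← mul_assoc, ← mul_pow, inv_mul_cancel₀ hs.ne', one_pow, one_mul]
    _ ≤ s⁻¹ ^ p * (Real.exp (s * x) * p.factorial) := by gcongr
    _ = _ := by ring

lemma lintegral_ofReal_pow_le_exp {s : ℝ} (hs : 0 < s) {p : ℕ} (hp : p ≠ 0) (f : Ω → ℝ) :
    ∫⁻ ω, ENNReal.ofReal (f ω) ^ p ∂P ≤ ENNReal.ofReal (p.factorial * s⁻¹ ^ p) *
      ∫⁻ ω, ENNReal.ofReal (Real.exp (s * f ω)) ∂P := by
  rw [← lintegral_const_mul' _ _ ENNReal.ofReal_ne_top]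
  exact lintegral_mono fun ω => ofReal_pow_le_exp hs hp (f ω)

lemma measure_nonneg_le_lintegral_exp {f : Ω → ℝ} (hf : AEMeasurable f P) :
    P {ω | 0 ≤ f ω} ≤ ∫⁻ ω, ENNReal.ofReal (Real.exp (f ω)) ∂P := by
  refine (measure_mono fun ω (hω : 0 ≤ f ω) => ?_).trans
    ((one_mul _).symm.trans_le (mul_meas_ge_le_lintegral₀ hf.exp.ennreal_ofReal 1))
  exact ENNReal.one_le_ofReal.2 (Real.one_le_exp hω)

lemma ofReal_abs_pow_eq_add {p : ℕ} (hp : p ≠ 0) (x : ℝ) :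
    ENNReal.ofReal |x| ^ p = ENNReal.ofReal x ^ p + ENNReal.ofReal (-x) ^ p := by
  rcases le_total 0 x with hx | hx
  · rw [abs_of_nonneg hx, ENNReal.ofReal_of_nonpos (neg_nonpos.2 hx), zero_pow hp, add_zero]
  · rw [abs_of_nonpos hx, ENNReal.ofReal_of_nonpos hx, zero_pow hp, zero_add]

lemma exp_sub_one_le_add_sq {t : ℝ} (ht : |t| ≤ 1) : Real.exp t - 1 ≤ t + t ^ 2 := by
  linarith [(le_abs_self _).trans (Real.abs_exp_sub_one_sub_id_le ht)]

end ExponentialMoments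

section BinomialMoments

variable {α ι : Type*} [Fintype ι] [MeasurableSpace α] (ν : Measure α) [IsProbabilityMeasure ν]
  {G : Set α} {p : ℕ}

lemma lintegral_hits_pow_le (hG : MeasurableSet G) (hp : p ≠ 0) :
    ∫⁻ y : ι → α, ENNReal.ofReal (hits G y) ^ p ∂(Measure.pi fun _ => ν)
      ≤ ENNReal.ofReal (p.factorial * Real.exp 2 * (1 + Fintype.card ι * ν.real G) ^ p) := by
  set q := (Fintype.card ι : ℝ) * ν.real G with hq
  have hq0 : 0 ≤ q := by positivity
  set s := (1 + q)⁻¹ with hs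
  have hs0 : 0 < s := by positivity
  have hs1 : s ≤ 1 := inv_le_one_of_one_le₀ (by linarith)
  have hqs : (1 + q) * s = 1 := mul_inv_cancel₀ (by positivity)
  have hexp : q * (Real.exp s - 1) ≤ 2 := by
    have := exp_sub_one_le_add_sq (abs_le.2 ⟨by linarith, hs1⟩)
    nlinarith
  have hmgf := lintegral_exp_mul_hits_sub_le (ι := ι) ν hG s 0
  simp only [sub_zero, mul_zero, ← hq] at hmgf
  calc _ ≤ ENNReal.ofReal (p.factorial * s⁻¹ ^ p) *
        ENNReal.ofReal (Real.exp (q * (Real.exp s - 1))) :=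
        (lintegral_ofReal_pow_le_exp _ hs0 hp _).trans (by gcongr)
    _ ≤ ENNReal.ofReal (p.factorial * s⁻¹ ^ p) * ENNReal.ofReal (Real.exp 2) := by gcongr
    _ = _ := by
        rw [← ENNReal.ofReal_mul (by positivity), hs, inv_inv]
        ring_nf

lemma lintegral_exp_mul_hits_sub_mean_le (hG : MeasurableSet G) {t : ℝ}
    (ht : t ^ 2 * (1 + Fintype.card ι * ν.real G) = 1) :
    ∫⁻ y : ι → α, ENNReal.ofReal (Real.exp (t * (hits G y - Fintype.card ι * ν.real G)))
      ∂(Measure.pi fun _ => ν) ≤ ENNReal.ofReal (Real.exp 1) := by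
  refine (lintegral_exp_mul_hits_sub_le ν hG t _).trans ?_
  have hq : 0 ≤ (Fintype.card ι : ℝ) * ν.real G := by positivity
  have hexp := exp_sub_one_le_add_sq (t := t) (abs_le_one_iff_mul_self_le_one.2 (by nlinarith))
  gcongr
  nlinarith [mul_le_mul_of_nonneg_left hexp hq, sq_nonneg t]

lemma lintegral_hits_sub_mean_pow_le (hG : MeasurableSet G) (hp : p ≠ 0) :
    ∫⁻ y : ι → α, ENNReal.ofReal |hits G y - Fintype.card ι * ν.real G| ^ p
        ∂(Measure.pi fun _ => ν)
      ≤ ENNReal.ofReal (2 * p.factorial * Real.exp 1 *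
          √(1 + Fintype.card ι * ν.real G) ^ p) := by
  set q := (Fintype.card ι : ℝ) * ν.real G
  set s := (√(1 + q))⁻¹ with hs
  have hs0 : 0 < s := by positivity
  have hss : s ^ 2 * (1 + q) = 1 := by
    rw [hs, inv_pow, Real.sq_sqrt (by positivity), inv_mul_cancel₀ (by positivity)]
  have hdev : Measurable fun y : ι → α => hits G y - q := (measurable_hits hG).sub_const q
  have hpos := lintegral_ofReal_pow_le_exp (Measure.pi fun _ : ι => ν) hs0 hp
    fun y => hits G y - q
  have hneg := lintegral_ofReal_pow_le_exp (Measure.pi fun _ : ι => ν) hs0 hp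
    fun y => -(hits G y - q)
  simp only [mul_neg, ← neg_mul] at hneg
  simp only [ofReal_abs_pow_eq_add hp]
  rw [lintegral_add_left (hdev.ennreal_ofReal.pow_const p)]
  calc _ ≤ ENNReal.ofReal (p.factorial * s⁻¹ ^ p) * ENNReal.ofReal (Real.exp 1) +
        ENNReal.ofReal (p.factorial * s⁻¹ ^ p) * ENNReal.ofReal (Real.exp 1) :=
        add_le_add
          (hpos.trans (by gcongr; exact lintegral_exp_mul_hits_sub_mean_le ν hG hss))
          (hneg.trans
            (by gcongr; exact lintegral_exp_mul_hits_sub_mean_le ν hG (by rwa [neg_sq])))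
    _ = _ := by
        rw [← ENNReal.ofReal_mul (by positivity), ← ENNReal.ofReal_add (by positivity)
          (by positivity), hs, inv_inv]
        ring_nf

lemma lintegral_hits_excess_pow_le (hG : MeasurableSet G) (hp : p ≠ 0) {μ : ℝ}
    (hμ : Fintype.card ι * ν.real G ≤ μ) :
    ∫⁻ y : ι → α, ENNReal.ofReal (hits G y - 2 * μ) ^ p ∂(Measure.pi fun _ => ν)
      ≤ ENNReal.ofReal (p.factorial * Real.exp (-(μ / 4))) := by
  have hexp : Fintype.card ι * ν.real G * (Real.exp 1 - 1) - 1 * (2 * μ) ≤ -(μ / 4) := by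
    have := Real.exp_one_lt_d9
    have := Real.add_one_le_exp 1
    have := mul_le_mul_of_nonneg_right hμ (by linarith : 0 ≤ Real.exp 1 - 1)
    have : 0 ≤ (Fintype.card ι : ℝ) * ν.real G := by positivity
    nlinarith
  calc _ ≤ ENNReal.ofReal (p.factorial * 1⁻¹ ^ p) *
        ENNReal.ofReal (Real.exp (Fintype.card ι * ν.real G * (Real.exp 1 - 1) - 1 * (2 * μ))) :=
        (lintegral_ofReal_pow_le_exp _ one_pos hp _).trans
          (by gcongr; exact lintegral_exp_mul_hits_sub_le ν hG 1 _)
    _ ≤ ENNReal.ofReal (p.factorial * 1⁻¹ ^ p) * ENNReal.ofReal (Real.exp (-(μ / 4))) := by gcongr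
    _ = _ := by
        rw [← ENNReal.ofReal_mul (by positivity), inv_one, one_pow, mul_one]

lemma pi_hits_lt_le_exp (hG : MeasurableSet G) {θ M : ℝ} (hθ0 : 0 ≤ θ) (hθ1 : θ < 1)
    (hM : M ≤ θ * (Fintype.card ι * ν.real G)) :
    (Measure.pi fun _ : ι => ν) {y | hits G y < M}
      ≤ ENNReal.ofReal (Real.exp (-(((1 - θ) / 2) ^ 2 * (Fintype.card ι * ν.real G)))) := by
  set q := (Fintype.card ι : ℝ) * ν.real G
  have hq0 : 0 ≤ q := by positivity
  set s := (1 - θ) / 2 with hs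
  have hexp := exp_sub_one_le_add_sq (t := -s) (abs_le.2 ⟨by linarith, by linarith⟩)
  have hbound : q * (Real.exp (-s) - 1) - -s * M ≤ -(s ^ 2 * q) := by
    have hθs : θ = 1 - 2 * s := by rw [hs]; ring
    rw [hθs] at hM
    nlinarith [mul_le_mul_of_nonneg_left hexp hq0]
  refine (measure_mono fun y (hy : hits G y < M) => ?_).trans
    ((measure_nonneg_le_lintegral_exp _
      (((measurable_hits hG).sub_const M).const_mul (-s)).aemeasurable).trans
    ((lintegral_exp_mul_hits_sub_le ν hG (-s) M).trans
      (ENNReal.ofReal_le_ofReal (Real.exp_le_exp.2 hbound))))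
  change 0 ≤ -s * (hits G y - M)
  nlinarith

lemma pi_le_hits_le_exp (hG : MeasurableSet G) {θ M : ℝ} (hθ0 : 0 ≤ θ) (hθ1 : θ < 1) (hM0 : 0 ≤ M)
    (hM : Fintype.card ι * ν.real G ≤ θ * M) :
    (Measure.pi fun _ : ι => ν) {y | M ≤ hits G y}
      ≤ ENNReal.ofReal (Real.exp (-(((1 - θ) / 2) ^ 2 * M))) := by
  set q := (Fintype.card ι : ℝ) * ν.real G
  set s := (1 - θ) / 2 with hs
  have hs0 : 0 < s := by rw [hs]; linarith
  have hθs : θ = 1 - 2 * s := by rw [hs]; ring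
  have hexp := exp_sub_one_le_add_sq (t := s) (abs_le.2 ⟨by linarith, by linarith⟩)
  have hbound : q * (Real.exp s - 1) - s * M ≤ -(s ^ 2 * M) := by
    have hq1 : q * (Real.exp s - 1) ≤ θ * M * (s + s ^ 2) :=
      mul_le_mul hM hexp (by linarith [Real.add_one_le_exp s]) (by positivity)
    rw [hθs] at hq1
    nlinarith [mul_nonneg hM0 (pow_pos hs0 3).le]
  refine (measure_mono fun y (hy : M ≤ hits G y) => ?_).trans
    ((measure_nonneg_le_lintegral_exp _
      (((measurable_hits hG).sub_const M).const_mul s).aemeasurable).trans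
    ((lintegral_exp_mul_hits_sub_le ν hG s M).trans
      (ENNReal.ofReal_le_ofReal (Real.exp_le_exp.2 hbound))))
  exact mul_nonneg hs0.le (sub_nonneg.2 hy)

end BinomialMoments

section RandomSets

variable {β γ : Type*} [MeasurableSpace β] [MeasurableSpace γ] {F : Set (β × γ)} {p : ℕ}

lemma measure_pow_le_setLIntegral_mul_lintegral_pow (ν : Measure γ) {G : Set γ} (hp : p ≠ 0)
    {b : γ → ℝ≥0∞} (hb : Measurable b) (hb0 : ∀ y, b y ≠ 0) (hbtop : ∀ y, b y ≠ ∞) :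
    ν G ^ p ≤ (∫⁻ y in G, (b y ^ (p - 1))⁻¹ ∂ν) * (∫⁻ y, b y ∂ν) ^ (p - 1) := by
  have hp0 : (p : ℝ) ≠ 0 := Nat.cast_ne_zero.2 hp
  have hp1 : ((p - 1 : ℕ) : ℝ) = p - 1 := by
    rw [Nat.cast_sub (Nat.one_le_iff_ne_zero.2 hp), Nat.cast_one]
  have hq : (0 : ℝ) ≤ 1 - 1 / p :=
    sub_nonneg.2 ((div_le_one (by positivity)).2 (by exact_mod_cast Nat.one_le_iff_ne_zero.2 hp))
  have hexp : ((p - 1 : ℕ) : ℝ) * (1 / p) = 1 - 1 / p := by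
    rw [hp1]
    field_simp
  have hone : ∀ y, ((b y ^ (p - 1))⁻¹) ^ (1 / p : ℝ) * b y ^ (1 - 1 / p : ℝ) = 1 := fun y => by
    rw [ENNReal.inv_rpow, ← ENNReal.rpow_natCast, ← ENNReal.rpow_mul, hexp]
    exact ENNReal.inv_mul_cancel (ENNReal.rpow_pos (pos_iff_ne_zero.2 (hb0 y)) (hbtop y)).ne'
      (ENNReal.rpow_ne_top_of_nonneg hq (hbtop y))
  have hholder : ν G ≤ (∫⁻ y in G, (b y ^ (p - 1))⁻¹ ∂ν) ^ (1 / p : ℝ)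
      * (∫⁻ y in G, b y ∂ν) ^ (1 - 1 / p : ℝ) := by
    have h := ENNReal.lintegral_mul_norm_pow_le (μ := ν.restrict G)
      (hb.pow_const (p - 1)).inv.aemeasurable hb.aemeasurable (one_div_nonneg.2 p.cast_nonneg) hq
      (add_sub_cancel _ _)
    simpa only [Pi.inv_apply, hone, lintegral_one, Measure.restrict_apply_univ] using h
  calc ν G ^ p ≤ ((∫⁻ y in G, (b y ^ (p - 1))⁻¹ ∂ν) ^ (1 / p : ℝ)
        * (∫⁻ y, b y ∂ν) ^ (1 - 1 / p : ℝ)) ^ p := by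
        refine pow_le_pow_left₀ zero_le (hholder.trans ?_) p
        gcongr
        exact Measure.restrict_le_self
    _ = (∫⁻ y in G, (b y ^ (p - 1))⁻¹ ∂ν) * (∫⁻ y, b y ∂ν) ^ (p - 1) := by
        rw [mul_pow, ← ENNReal.rpow_natCast, ← ENNReal.rpow_natCast _ p,
          ← ENNReal.rpow_natCast _ (p - 1), ← ENNReal.rpow_mul, ← ENNReal.rpow_mul, hp1,
          one_div_mul_cancel hp0, ENNReal.rpow_one, sub_mul, one_mul, one_div_mul_cancel hp0]

/-- Minkowski's integral inequality for an indicator: Hölder with the weight `b ^ (p - 1)`, then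
Tonelli. -/
lemma lintegral_measure_section_pow_le (μ : Measure β) [SFinite μ] (ν : Measure γ) [SFinite ν]
    (hF : MeasurableSet F) (hp : p ≠ 0) {b : γ → ℝ≥0∞}
    (hb : Measurable b) (hb0 : ∀ y, b y ≠ 0) (hbtop : ∀ y, b y ≠ ∞)
    (h : ∀ y, μ {w | (w, y) ∈ F} ≤ b y ^ p) :
    ∫⁻ w, ν {y | (w, y) ∈ F} ^ p ∂μ ≤ (∫⁻ y, b y ∂ν) ^ p := by
  have hFw : ∀ w, MeasurableSet {y | (w, y) ∈ F} := fun w => measurable_prodMk_left hF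
  have hFy : ∀ y, MeasurableSet {w | (w, y) ∈ F} := fun y => measurable_prodMk_right hF
  have hweighted : Measurable (F.indicator fun z => (b z.2 ^ (p - 1))⁻¹) :=
    ((hb.comp measurable_snd).pow_const _).inv.indicator hF
  have hsection : ∀ w, ∫⁻ y in {y | (w, y) ∈ F}, (b y ^ (p - 1))⁻¹ ∂ν
      = ∫⁻ y, F.indicator (fun z => (b z.2 ^ (p - 1))⁻¹) (w, y) ∂ν := fun w => by
    rw [← lintegral_indicator (hFw w)]
    rfl
  have hfubini : ∫⁻ w, ∫⁻ y in {y | (w, y) ∈ F}, (b y ^ (p - 1))⁻¹ ∂ν ∂μ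
      = ∫⁻ y, (b y ^ (p - 1))⁻¹ * μ {w | (w, y) ∈ F} ∂ν := by
    calc _ = ∫⁻ w, ∫⁻ y, F.indicator (fun z => (b z.2 ^ (p - 1))⁻¹) (w, y) ∂ν ∂μ :=
          lintegral_congr hsection
      _ = ∫⁻ y, ∫⁻ w, F.indicator (fun z => (b z.2 ^ (p - 1))⁻¹) (w, y) ∂μ ∂ν :=
          lintegral_lintegral_swap hweighted.aemeasurable
      _ = _ := by
          refine lintegral_congr fun y => ?_
          rw [← setLIntegral_const, ← lintegral_indicator (hFy y)]
          rfl
  calc ∫⁻ w, ν {y | (w, y) ∈ F} ^ p ∂μ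
    _ ≤ ∫⁻ w, (∫⁻ y in {y | (w, y) ∈ F}, (b y ^ (p - 1))⁻¹ ∂ν)
          * (∫⁻ y, b y ∂ν) ^ (p - 1) ∂μ :=
        lintegral_mono fun w => measure_pow_le_setLIntegral_mul_lintegral_pow ν hp hb hb0 hbtop
    _ = (∫⁻ y, (b y ^ (p - 1))⁻¹ * μ {w | (w, y) ∈ F} ∂ν) * (∫⁻ y, b y ∂ν) ^ (p - 1) := by
        rw [lintegral_mul_const, hfubini]
        simpa only [hsection] using hweighted.lintegral_prod_right'
    _ ≤ (∫⁻ y, b y ∂ν) * (∫⁻ y, b y ∂ν) ^ (p - 1) := by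
        gcongr with y
        calc _ ≤ (b y ^ (p - 1))⁻¹ * b y ^ p := mul_le_mul_right (h y) _
          _ = b y := by
            rw [← mul_pow_sub_one hp, mul_left_comm,
              ENNReal.inv_mul_cancel (pow_ne_zero _ (hb0 y)) (ENNReal.pow_ne_top (hbtop y)),
              mul_one]
    _ = (∫⁻ y, b y ∂ν) ^ p := mul_pow_sub_one hp _

lemma measurable_hits_section {k : ℕ} (hF : MeasurableSet F) :
    Measurable fun z : β × (Fin k → γ) => hits {y | (z.1, y) ∈ F} z.2 := by
  refine Finset.measurable_sum _ fun j _ => ?_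
  have hpair : Measurable fun z : β × (Fin k → γ) => (z.1, z.2 j) := by fun_prop
  exact (Measurable.indicator measurable_const hF).comp hpair

lemma lintegral_hits_section_pow_le (μ : Measure β) [IsProbabilityMeasure μ] (ν : Measure γ)
    [IsProbabilityMeasure ν] (k : ℕ) (hF : MeasurableSet F) (hp : p ≠ 0) :
    ∫⁻ z : β × (Fin k → γ), ENNReal.ofReal (hits {y | (z.1, y) ∈ F} z.2) ^ p
        ∂(μ.prod (Measure.pi fun _ => ν))
      ≤ ENNReal.ofReal (p.factorial * Real.exp 2) * (2 ^ p *
        (1 + (k : ℝ≥0∞) ^ p * ∫⁻ w, ν {y | (w, y) ∈ F} ^ p ∂μ)) := by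
  have hbinomial : ∀ w, ∫⁻ y : Fin k → γ, ENNReal.ofReal (hits {y | (w, y) ∈ F} y) ^ p
        ∂(Measure.pi fun _ => ν)
      ≤ ENNReal.ofReal (p.factorial * Real.exp 2) * (1 + k * ν {y | (w, y) ∈ F}) ^ p := fun w => by
    refine (lintegral_hits_pow_le ν (measurable_prodMk_left hF) hp).trans_eq ?_
    rw [ENNReal.ofReal_mul (q := (1 + _) ^ p) (by positivity), ENNReal.ofReal_pow (by positivity),
      ENNReal.ofReal_add zero_le_one (by positivity), ENNReal.ofReal_one,
      ENNReal.ofReal_mul (q := ν.real _) (by positivity), Fintype.card_fin, ENNReal.ofReal_natCast,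
      ofReal_measureReal]
    rfl
  rw [lintegral_prod _ ((measurable_hits_section hF).ennreal_ofReal.pow_const p).aemeasurable]
  calc _ ≤ ∫⁻ w, ENNReal.ofReal (p.factorial * Real.exp 2)
          * (1 + k * ν {y | (w, y) ∈ F}) ^ p ∂μ := lintegral_mono hbinomial
    _ ≤ ENNReal.ofReal (p.factorial * Real.exp 2) * (2 ^ p *
          (∫⁻ _, 1 ^ p ∂μ + ∫⁻ w, (k * ν {y | (w, y) ∈ F}) ^ p ∂μ)) := by
        rw [lintegral_const_mul' _ _ ENNReal.ofReal_ne_top]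
        gcongr
        exact lintegral_add_pow_le aemeasurable_const p
    _ = _ := by
        simp_rw [one_pow, lintegral_one, measure_univ, mul_pow]
        rw [lintegral_const_mul' _ _ (by finiteness)]

lemma lintegral_hits_section_pow_le_of_exp_rate (μ : Measure β) [IsProbabilityMeasure μ]
    (ν : Measure γ) [IsProbabilityMeasure ν] (k : ℕ) (hF : MeasurableSet F) (hp : p ≠ 0)
    {S : Set γ} (hFS : ∀ z ∈ F, z.2 ∈ S) {rate : γ → ℝ} (hrate : Measurable rate)
    (hprob : ∀ y ∈ S, μ {w | (w, y) ∈ F} ≤ ENNReal.ofReal (Real.exp (-(p * rate y)))) :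
    ∫⁻ z : β × (Fin k → γ), ENNReal.ofReal (hits {y | (z.1, y) ∈ F} z.2) ^ p
        ∂(μ.prod (Measure.pi fun _ => ν))
      ≤ ENNReal.ofReal (p.factorial * Real.exp 2) * (2 ^ p * (1 + (k : ℝ≥0∞) ^ p *
        (∫⁻ y in S, ENNReal.ofReal (Real.exp (-(rate y))) ∂ν) ^ p)) := by
  have hsection : ∀ w, ν.restrict S {y | (w, y) ∈ F} = ν {y | (w, y) ∈ F} := fun w =>
    Measure.restrict_eq_self _ fun y hy => hFS (w, y) hy
  have hminkowski := lintegral_measure_section_pow_le μ (ν.restrict S) hF hp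
    (b := fun y => ENNReal.ofReal (Real.exp (-(rate y)))) hrate.neg.exp.ennreal_ofReal
    (fun y => by simp [Real.exp_pos]) (fun y => by simp) (fun y => by
      by_cases hy : y ∈ S
      · rw [← ENNReal.ofReal_pow (Real.exp_pos _).le, ← Real.exp_nat_mul, mul_neg]
        exact hprob y hy
      · rw [Set.eq_empty_of_forall_notMem (s := {w | (w, y) ∈ F}) fun w hw => hy (hFS (w, y) hw),
          measure_empty]
        exact zero_le)
  simp_rw [hsection] at hminkowski
  refine (lintegral_hits_section_pow_le μ ν k hF hp).trans ?_
  gcongr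

end RandomSets

section Density

variable {α : Type*} [MeasurableSpace α] {μ : Measure α} {f : α → ℝ} {S : Set α} {b : ℝ}

lemma restrict_withDensity_le_smul (hS : MeasurableSet S) (hb : ∀ y ∈ S, f y ≤ b) :
    (μ.withDensity fun y => ENNReal.ofReal (f y)).restrict S ≤ ENNReal.ofReal b • μ := by
  rw [restrict_withDensity hS, ← withDensity_const]
  calc _ ≤ (μ.restrict S).withDensity fun _ => ENNReal.ofReal b :=
        withDensity_mono (ae_restrict_of_forall_mem hS fun y hy =>
          ENNReal.ofReal_le_ofReal (hb y hy))
    _ ≤ _ := by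
        rw [withDensity_const, withDensity_const]
        gcongr
        exact Measure.restrict_le_self

lemma smul_restrict_le_withDensity (hS : MeasurableSet S) (hb : ∀ y ∈ S, b ≤ f y) :
    ENNReal.ofReal b • μ.restrict S ≤ μ.withDensity fun y => ENNReal.ofReal (f y) := by
  calc _ = (μ.restrict S).withDensity fun _ => ENNReal.ofReal b := (withDensity_const _).symm
    _ ≤ (μ.restrict S).withDensity fun y => ENNReal.ofReal (f y) :=
        withDensity_mono (ae_restrict_of_forall_mem hS fun y hy =>
          ENNReal.ofReal_le_ofReal (hb y hy))
    _ ≤ _ := by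
        rw [← restrict_withDensity hS]
        exact Measure.restrict_le_self

end Density

section Euclidean

variable {m : ℕ}

/-- The volume of the unit ball of `ℝᵐ`. -/
noncomputable def unitBallVolume (m : ℕ) : ℝ := volume.real (Metric.ball (0 : E m) 1)

lemma unitBallVolume_pos (m : ℕ) : 0 < unitBallVolume m :=
  ENNReal.toReal_pos (Metric.measure_ball_pos _ _ one_pos).ne' measure_ball_lt_top.ne

lemma volume_real_closedBall (y : E m) {t : ℝ} (ht : 0 ≤ t) :
    volume.real (Metric.closedBall y t) = t ^ m * unitBallVolume m := by
  rw [unitBallVolume, Measure.addHaar_real_closedBall _ _ ht, finrank_euclideanSpace_fin]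

lemma volume_real_ball (hm : m ≠ 0) (y : E m) {t : ℝ} (ht : 0 ≤ t) :
    volume.real (Metric.ball y t) = t ^ m * unitBallVolume m := by
  have : Nonempty (Fin m) := Fin.pos_iff_nonempty.1 (Nat.pos_of_ne_zero hm)
  rw [unitBallVolume, measureReal_def, Measure.addHaar_ball _ _ ht, ENNReal.toReal_mul,
    ENNReal.toReal_ofReal (by positivity), finrank_euclideanSpace_fin, measureReal_def]

variable {ν : Measure (E m)} {S : Set (E m)} {b : ℝ} {y : E m} {t : ℝ}

lemma mul_pow_le_measureReal_ball [IsFiniteMeasure ν] (hm : m ≠ 0)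
    (hν : ENNReal.ofReal b • volume.restrict S ≤ ν) (ht : 0 ≤ t) (hball : Metric.ball y t ⊆ S) :
    b * (t ^ m * unitBallVolume m) ≤ ν.real (Metric.ball y t) := by
  have hV := unitBallVolume_pos m
  have h := ENNReal.toReal_mono (measure_ne_top ν _) (hν (Metric.ball y t))
  rw [Measure.smul_apply, Measure.restrict_eq_self _ hball, smul_eq_mul, ENNReal.toReal_mul,
    ENNReal.toReal_ofReal', ← measureReal_def, ← measureReal_def, volume_real_ball hm y ht] at h
  exact (mul_le_mul_of_nonneg_right (le_max_left b 0) (by positivity)).trans h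

lemma measureReal_closedBall_le_mul_pow (hb : 0 ≤ b)
    (hν : ν.restrict S ≤ ENNReal.ofReal b • volume) (ht : 0 ≤ t)
    (hball : Metric.closedBall y t ⊆ S) :
    ν.real (Metric.closedBall y t) ≤ b * (t ^ m * unitBallVolume m) := by
  have h := hν (Metric.closedBall y t)
  rw [Measure.smul_apply, Measure.restrict_eq_self _ hball, smul_eq_mul] at h
  have h' := ENNReal.toReal_mono
    (ENNReal.mul_ne_top ENNReal.ofReal_ne_top measure_closedBall_lt_top.ne) h
  rwa [ENNReal.toReal_mul, ENNReal.toReal_ofReal hb, ← measureReal_def, ← measureReal_def,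
    volume_real_closedBall y ht] at h'

lemma lintegral_exp_neg_mul_norm_sub_pow (hm : m ≠ 0) {a : ℝ} (ha : 0 < a) (y₀ : E m) :
    ∫⁻ y, ENNReal.ofReal (Real.exp (-(a * ‖y - y₀‖ ^ m)))
      = ENNReal.ofReal (unitBallVolume m / a) := by
  have hm0 : (m : ℝ) ≠ 0 := Nat.cast_ne_zero.2 hm
  have : Nonempty (Fin m) := Fin.pos_iff_nonempty.1 (Nat.pos_of_ne_zero hm)
  have hradial : ∫ t in Set.Ioi (0 : ℝ), t ^ (m - 1) * Real.exp (-(a * t ^ m)) = 1 / (m * a) := by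
    have h := integral_rpow_mul_exp_neg_mul_rpow (p := m) (q := (m - 1 : ℕ)) (by positivity)
      (by linarith [(m - 1 : ℕ).cast_nonneg (α := ℝ)]) ha
    rw [Nat.cast_sub (Nat.one_le_iff_ne_zero.2 hm), Nat.cast_one, sub_add_cancel, neg_div,
      div_self hm0, Real.Gamma_one, Real.rpow_neg_one] at h
    rw [← Nat.cast_one, ← Nat.cast_sub (Nat.one_le_iff_ne_zero.2 hm)] at h
    simp only [Real.rpow_natCast, neg_mul] at h
    rw [h]
    simp [mul_comm]
  have hintegral : ∫ y : E m, Real.exp (-(a * ‖y‖ ^ m)) = unitBallVolume m / a := by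
    rw [integral_fun_norm_addHaar volume fun t => Real.exp (-(a * t ^ m)),
      finrank_euclideanSpace_fin, ← unitBallVolume]
    simp only [smul_eq_mul, nsmul_eq_mul, hradial]
    field_simp
  have hpos : 0 < unitBallVolume m / a := div_pos (unitBallVolume_pos m) ha
  rw [lintegral_sub_right_eq_self fun y : E m => ENNReal.ofReal (Real.exp (-(a * ‖y‖ ^ m))),
    ← hintegral, ofReal_integral_eq_lintegral_ofReal
      (Integrable.of_integral_ne_zero (hintegral.trans_ne hpos.ne'))
      (Eventually.of_forall fun _ => (Real.exp_pos _).le)]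

lemma tendsto_measureReal_closedBall_div_volume {f : E m → ℝ}
    [IsFiniteMeasure (volume.withDensity fun y => ENNReal.ofReal (f y))] {y₀ : E m}
    (hm : m ≠ 0) (hf : 0 ≤ f y₀) (hc : ContinuousAt f y₀) :
    Tendsto (fun t => (volume.withDensity fun y => ENNReal.ofReal (f y)).real
      (Metric.closedBall y₀ t) / (t ^ m * unitBallVolume m)) (𝓝[>] 0) (𝓝 (f y₀)) := by
  have hV := unitBallVolume_pos m
  have hsmall : ∀ δ > 0, ∀ᶠ t : ℝ in 𝓝[>] 0, 0 < t ∧ Metric.closedBall y₀ t ⊆ Metric.ball y₀ δ :=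
    fun δ hδ => by
      filter_upwards [self_mem_nhdsWithin, nhdsWithin_le_nhds (gt_mem_nhds hδ)] with t ht0 htδ
      exact ⟨ht0, Metric.closedBall_subset_ball htδ⟩
  refine tendsto_order.2 ⟨fun a ha => ?_, fun b hb => ?_⟩
  · obtain ⟨a', ha', ha'f⟩ := exists_between ha
    obtain ⟨δ, hδ, hball⟩ := Metric.eventually_nhds_iff_ball.1 (hc.eventually_const_lt ha'f)
    filter_upwards [hsmall δ hδ] with t ht
    have ht0 := ht.1
    refine ha'.trans_le ((le_div_iff₀ (by positivity)).2 ?_)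
    calc a' * (t ^ m * unitBallVolume m) ≤ _ :=
          mul_pow_le_measureReal_ball hm
            (smul_restrict_le_withDensity measurableSet_ball fun y hy => (hball y hy).le) ht0.le
            (Metric.ball_subset_closedBall.trans ht.2)
      _ ≤ _ := measureReal_mono Metric.ball_subset_closedBall
  · obtain ⟨b', hb'f, hb'⟩ := exists_between hb
    obtain ⟨δ, hδ, hball⟩ := Metric.eventually_nhds_iff_ball.1 (hc.eventually_lt_const hb'f)
    filter_upwards [hsmall δ hδ] with t ht
    have ht0 := ht.1
    refine lt_of_le_of_lt ((div_le_iff₀ (by positivity)).2 ?_) hb'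
    exact measureReal_closedBall_le_mul_pow (hf.trans hb'f.le)
      (restrict_withDensity_le_smul measurableSet_ball fun y hy => (hball y hy).le) ht0.le ht.2

end Euclidean

section Regime

/-- The contribution of a single matched point to the estimator of the density ratio, for `N` and
`k` sample points and `M` matches. -/
noncomputable def matchScale (N k M : ℕ) : ℝ := N / (k * M)

lemma matchScale_nonneg (N k M : ℕ) : 0 ≤ matchScale N k M := by
  unfold matchScale
  positivity

lemma matchScale_mul {N k M : ℕ} (hk : k ≠ 0) : matchScale N k M * k = N / M := by
  have : (k : ℝ) ≠ 0 := Nat.cast_ne_zero.2 hk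
  unfold matchScale
  field_simp

lemma ofReal_matchScale_mul {N k M : ℕ} (hk : k ≠ 0) :
    ENNReal.ofReal (matchScale N k M) * k = ENNReal.ofReal (N / M) := by
  rw [← ENNReal.ofReal_natCast k, ← ENNReal.ofReal_mul (matchScale_nonneg N k M),
    matchScale_mul hk]

/-- The asymptotic regime of the theorem: there are `N` and `N₁ N` sample points and `M N` matches,
the matched fraction `M N / N` vanishes, and both the number of matches and the typical number of
matched times `M N * N₁ N / N` of a point grow to infinity. -/
structure MatchingRegime (M N₁ : ℕ → ℕ) : Prop where
  tendsto_fraction : Tendsto (fun N => (M N : ℝ) / N) atTop (𝓝 0)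
  tendsto_mean : Tendsto (fun N => (M N : ℝ) * N₁ N / N) atTop atTop
  tendsto_count : Tendsto M atTop atTop

namespace MatchingRegime

variable {M N₁ : ℕ → ℕ}

lemma eventually_ne_zero (h : MatchingRegime M N₁) :
    ∀ᶠ N in atTop, N ≠ 0 ∧ M N ≠ 0 ∧ N₁ N ≠ 0 := by
  filter_upwards [eventually_ne_atTop 0, h.tendsto_count.eventually_ne_atTop 0,
    h.tendsto_mean.eventually_gt_atTop 0] with N hN hM hmean
  refine ⟨hN, hM, fun h0 => ?_⟩
  simp [h0] at hmean

lemma tendsto_matchScale (h : MatchingRegime M N₁) :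
    Tendsto (fun N => matchScale N (N₁ N) (M N)) atTop (𝓝 0) := by
  refine h.tendsto_mean.inv_tendsto_atTop.congr fun N => ?_
  rw [Pi.inv_apply, inv_div, mul_comm, matchScale]

lemma eventually_le (h : MatchingRegime M N₁) : ∀ᶠ N in atTop, M N ≤ N := by
  filter_upwards [eventually_gt_atTop 0, h.tendsto_fraction.eventually_le_const one_pos]
    with N hN hMN
  rwa [div_le_one (Nat.cast_pos.2 hN), Nat.cast_le] at hMN

end MatchingRegime

/-- The radius of the ball that is expected to contain `M` out of `N` independent points of `ℝᵐ`
whose density is constantly equal to `κ`. -/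
noncomputable def matchRadius (m : ℕ) (κ : ℝ) (M N : ℕ) : ℝ :=
  (M / (N * (κ * unitBallVolume m))) ^ (1 / (m : ℝ))

variable {m : ℕ} {κ : ℝ} {M N₁ : ℕ → ℕ}

lemma matchRadius_nonneg (hκ : 0 < κ) (M N : ℕ) : 0 ≤ matchRadius m κ M N := by
  have := unitBallVolume_pos m
  unfold matchRadius
  positivity

lemma mul_matchRadius_pow (hm : m ≠ 0) (hκ : 0 < κ) (M : ℕ) {N : ℕ} (hN : N ≠ 0) :
    N * (κ * (matchRadius m κ M N ^ m * unitBallVolume m)) = M := by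
  have hV := unitBallVolume_pos m
  have hN' : (N : ℝ) ≠ 0 := Nat.cast_ne_zero.2 hN
  rw [matchRadius, ← Real.rpow_natCast, ← Real.rpow_mul (by positivity),
    one_div_mul_cancel (Nat.cast_ne_zero.2 hm), Real.rpow_one]
  field_simp

lemma matchRadius_pos (hm : m ≠ 0) (hκ : 0 < κ) {M N : ℕ} (hN : N ≠ 0) (hM : M ≠ 0) :
    0 < matchRadius m κ M N := by
  refine (matchRadius_nonneg hκ M N).lt_of_ne' fun h0 => hM ?_
  have h := mul_matchRadius_pow hm hκ M hN
  rw [h0, zero_pow hm, zero_mul, mul_zero, mul_zero] at h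
  exact_mod_cast h.symm

lemma MatchingRegime.tendsto_matchRadius (h : MatchingRegime M N₁) (hm : m ≠ 0) :
    Tendsto (fun N => matchRadius m κ (M N) N) atTop (𝓝 0) := by
  have hm' : (0 : ℝ) < 1 / m := one_div_pos.2 (Nat.cast_pos.2 (Nat.pos_of_ne_zero hm))
  have hlim := (h.tendsto_fraction.div_const (κ * unitBallVolume m)).rpow_const (p := 1 / (m : ℝ))
    (Or.inr hm'.le)
  rw [zero_div, Real.zero_rpow hm'.ne'] at hlim
  simpa only [matchRadius, div_div] using hlim

lemma MatchingRegime.tendsto_measureReal_closedBall (h : MatchingRegime M N₁) (hm : m ≠ 0)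
    (hκ : 0 < κ) {f : E m → ℝ} [IsFiniteMeasure (volume.withDensity fun y => ENNReal.ofReal (f y))]
    {y₀ : E m} (hf : 0 ≤ f y₀) (hc : ContinuousAt f y₀) {a : ℝ} (ha : 0 < a) :
    Tendsto (fun N : ℕ => N / M N * (volume.withDensity fun y => ENNReal.ofReal (f y)).real
      (Metric.closedBall y₀ (a * matchRadius m κ (M N) N))) atTop (𝓝 (f y₀ / κ * a ^ m)) := by
  have hV := unitBallVolume_pos m
  have hradius : Tendsto (fun N => a * matchRadius m κ (M N) N) atTop (𝓝[>] 0) := by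
    refine tendsto_nhdsWithin_iff.2 ⟨by simpa using (h.tendsto_matchRadius hm).const_mul a, ?_⟩
    filter_upwards [h.eventually_ne_zero] with N hN
    exact mul_pos ha (matchRadius_pos hm hκ hN.1 hN.2.1)
  have hlim := ((tendsto_measureReal_closedBall_div_volume hm hf hc).comp hradius).mul_const
    (a ^ m / κ)
  rw [mul_div_assoc', mul_div_right_comm] at hlim
  refine hlim.congr' ?_
  filter_upwards [h.eventually_ne_zero] with N hNM
  obtain ⟨hN, hM, -⟩ := hNM
  have hρ := matchRadius_pos hm hκ hN hM
  have hN' : (N : ℝ) ≠ 0 := Nat.cast_ne_zero.2 hN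
  have hvolume := mul_matchRadius_pow hm hκ (M N) hN
  simp only [Function.comp_apply]
  rw [mul_pow, ← hvolume]
  field_simp

end Regime

section SampleLaw

variable {m : ℕ} {ν₀ ν₁ : Measure (E m)} [IsProbabilityMeasure ν₀] [IsProbabilityMeasure ν₁]
  {M N₁ : ℕ → ℕ} {p : ℕ}

/-- The joint law of `N` points with law `ν₀` and `k` points with law `ν₁`, all independent. -/
noncomputable abbrev sampleLaw (ν₀ ν₁ : Measure (E m)) (N k : ℕ) :
    Measure ((Fin N → E m) × (Fin k → E m)) :=
  (Measure.pi fun _ => ν₀).prod (Measure.pi fun _ => ν₁)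

lemma vanishesInLp_abs_hits_sub_mean (h : MatchingRegime M N₁) (hp : p ≠ 0) {S : ℕ → Set (E m)}
    (hS : ∀ N, MeasurableSet (S N)) {L : ℝ}
    (hL : Tendsto (fun N : ℕ => N / M N * ν₁.real (S N)) atTop (𝓝 L)) :
    VanishesInLp (fun N => Measure.pi fun _ : Fin (N₁ N) => ν₁) p fun N y =>
      ENNReal.ofReal (matchScale N (N₁ N) (M N)) *
        ENNReal.ofReal |hits (S N) y - N₁ N * ν₁.real (S N)| := by
  set c := fun N => matchScale N (N₁ N) (M N)
  refine ⟨fun N => (((measurable_hits (hS N)).sub_const _).abs.ennreal_ofReal.const_mul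
    _).aemeasurable, ?_⟩
  have hlim : Tendsto (fun N => 2 * p.factorial * Real.exp 1 *
      √(c N * (c N + N / M N * ν₁.real (S N))) ^ p) atTop (𝓝 0) := by
    simpa [hp] using ((((h.tendsto_matchScale.mul
      (h.tendsto_matchScale.add hL)).sqrt).pow p).const_mul (2 * p.factorial * Real.exp 1))
  refine tendsto_of_tendsto_of_tendsto_of_le_of_le' tendsto_const_nhds
    (by simpa using ENNReal.tendsto_ofReal hlim) (Eventually.of_forall fun _ => zero_le) ?_
  filter_upwards [h.eventually_ne_zero] with N hN
  have hc0 : 0 ≤ c N := matchScale_nonneg N (N₁ N) (M N)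
  have hscaling : c N ^ p * √(1 + N₁ N * ν₁.real (S N)) ^ p
      = √(c N * (c N + N / M N * ν₁.real (S N))) ^ p := by
    rw [← mul_pow, ← matchScale_mul hN.2.2]
    nth_rewrite 1 [← Real.sqrt_sq hc0]
    rw [← Real.sqrt_mul (by positivity)]
    congr 2
    ring
  have hmoment := lintegral_hits_sub_mean_pow_le (ι := Fin (N₁ N)) ν₁ (hS N) hp
  rw [Fintype.card_fin] at hmoment
  simp_rw [mul_pow]
  rw [lintegral_const_mul' _ _ (by finiteness)]
  calc _ ≤ ENNReal.ofReal (c N) ^ p * ENNReal.ofReal (2 * p.factorial * Real.exp 1 *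
          √(1 + N₁ N * ν₁.real (S N)) ^ p) := mul_le_mul_right hmoment _
    _ = _ := by
      rw [← ENNReal.ofReal_pow hc0, ← ENNReal.ofReal_mul (by positivity), mul_left_comm, hscaling]

lemma vanishesInLp_abs_hits_sub (h : MatchingRegime M N₁) (hp : p ≠ 0) {S : ℕ → Set (E m)}
    (hS : ∀ N, MeasurableSet (S N)) {L : ℝ}
    (hL : Tendsto (fun N : ℕ => N / M N * ν₁.real (S N)) atTop (𝓝 L)) :
    VanishesInLp (fun N => Measure.pi fun _ : Fin (N₁ N) => ν₁) p fun N y =>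
      ENNReal.ofReal |matchScale N (N₁ N) (M N) * hits (S N) y - L| := by
  have hbias : Tendsto (fun N : ℕ => ENNReal.ofReal |N / M N * ν₁.real (S N) - L|) atTop (𝓝 0) := by
    simpa using ENNReal.tendsto_ofReal (hL.sub_const L).abs
  refine ((vanishesInLp_abs_hits_sub_mean h hp hS hL).add (.of_tendsto hp hbias)).mono
    (fun N => (((measurable_hits (hS N)).const_mul _).sub_const _).abs.ennreal_ofReal.aemeasurable)
    ?_
  filter_upwards [h.eventually_ne_zero] with N hN
  refine Eventually.of_forall fun y => ?_
  set c := matchScale N (N₁ N) (M N)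
  have hc0 : 0 ≤ c := matchScale_nonneg N (N₁ N) (M N)
  rw [← ENNReal.ofReal_mul hc0, ← ENNReal.ofReal_add (by positivity) (by positivity)]
  refine ENNReal.ofReal_le_ofReal ?_
  calc |c * hits (S N) y - L|
      = |c * (hits (S N) y - N₁ N * ν₁.real (S N)) + (N / M N * ν₁.real (S N) - L)| := by
        rw [← matchScale_mul hN.2.2]
        congr 1
        ring
    _ ≤ _ := by
        refine (abs_add_le _ _).trans_eq ?_
        rw [abs_mul, abs_of_nonneg hc0]

lemma vanishesInLp_hits_section (h : MatchingRegime M N₁) (hp : p ≠ 0)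
    {F : ∀ N : ℕ, Set ((Fin N → E m) × E m)} (hF : ∀ N, MeasurableSet (F N)) {S : ℕ → Set (E m)}
    (hFS : ∀ N, ∀ z ∈ F N, z.2 ∈ S N) {rate : ℕ → E m → ℝ} (hrate : ∀ N, Measurable (rate N))
    (hprob : ∀ᶠ N in atTop, ∀ y ∈ S N, (Measure.pi fun _ : Fin N => ν₀) {w | (w, y) ∈ F N}
      ≤ ENNReal.ofReal (Real.exp (-(p * rate N y))))
    (hlim : Tendsto (fun N : ℕ => ENNReal.ofReal (N / M N) *
      ∫⁻ y in S N, ENNReal.ofReal (Real.exp (-(rate N y))) ∂ν₁) atTop (𝓝 0)) :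
    VanishesInLp (fun N => sampleLaw ν₀ ν₁ N (N₁ N)) p fun N z =>
      ENNReal.ofReal (matchScale N (N₁ N) (M N)) *
        ENNReal.ofReal (hits {y | (z.1, y) ∈ F N} z.2) := by
  refine ⟨fun N => ((measurable_hits_section (hF N)).ennreal_ofReal.const_mul _).aemeasurable, ?_⟩
  set C : ℝ≥0∞ := ENNReal.ofReal (p.factorial * Real.exp 2) * 2 ^ p with hC
  have hbound : Tendsto (fun N : ℕ => C * (ENNReal.ofReal (matchScale N (N₁ N) (M N)) ^ p +
      (ENNReal.ofReal (N / M N) *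
        ∫⁻ y in S N, ENNReal.ofReal (Real.exp (-(rate N y))) ∂ν₁) ^ p)) atTop (𝓝 0) := by
    have hscale := ENNReal.tendsto_ofReal h.tendsto_matchScale
    simpa [hp] using ENNReal.Tendsto.const_mul (a := C)
      (((ENNReal.continuous_pow p).tendsto _).comp hscale |>.add
        (((ENNReal.continuous_pow p).tendsto _).comp hlim)) (Or.inr (by finiteness))
  refine tendsto_of_tendsto_of_tendsto_of_le_of_le' tendsto_const_nhds hbound
    (Eventually.of_forall fun _ => zero_le) ?_
  filter_upwards [h.eventually_ne_zero, hprob] with N hN hprobN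
  simp_rw [mul_pow]
  rw [lintegral_const_mul' _ _ (by finiteness)]
  refine (mul_le_mul_right (lintegral_hits_section_pow_le_of_exp_rate _ ν₁ (N₁ N) (hF N) hp (hFS N)
    (hrate N) hprobN) _).trans_eq ?_
  rw [hC, ← ofReal_matchScale_mul hN.2.2]
  ring

end SampleLaw

section UnusualBalls

variable {m n : ℕ} {S : Set (E m)} {τ : E m → ℝ}

/-- The pairs of a sample `w` and a point `y` of `S` such that fewer than `M` of the sample points
lie in the ball of radius `τ y` around `y`. -/
def sparseSet (S : Set (E m)) (τ : E m → ℝ) (M n : ℕ) : Set ((Fin n → E m) × E m) :=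
  {z | z.2 ∈ S ∧ hits (Metric.ball z.2 (τ z.2)) z.1 < M}

/-- The pairs of a sample `w` and a point `y` of `S` such that at least `M` of the sample points
lie in the ball of radius `τ y` around `y`. -/
def crowdedSet (S : Set (E m)) (τ : E m → ℝ) (M n : ℕ) : Set ((Fin n → E m) × E m) :=
  {z | z.2 ∈ S ∧ M ≤ hits (Metric.ball z.2 (τ z.2)) z.1}

lemma measurable_hits_ball (hτ : Measurable τ) :
    Measurable fun z : (Fin n → E m) × E m => hits (Metric.ball z.2 (τ z.2)) z.1 := by
  refine Finset.measurable_sum _ fun i _ => Measurable.indicator (measurable_const (a := (1 : ℝ)))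
    (s := {z : (Fin n → E m) × E m | z.1 i ∈ Metric.ball z.2 (τ z.2)}) ?_
  simp only [Metric.mem_ball]
  exact measurableSet_lt (by fun_prop) (by fun_prop)

lemma measurableSet_sparseSet (hS : MeasurableSet S) (hτ : Measurable τ) (M n : ℕ) :
    MeasurableSet (sparseSet S τ M n) :=
  (measurable_snd hS).inter (measurableSet_lt (measurable_hits_ball hτ) measurable_const)

lemma measurableSet_crowdedSet (hS : MeasurableSet S) (hτ : Measurable τ) (M n : ℕ) :
    MeasurableSet (crowdedSet S τ M n) :=
  (measurable_snd hS).inter (measurableSet_le measurable_const (measurable_hits_ball hτ))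

end UnusualBalls

section BallProbabilities

variable {m n M : ℕ} {ν : Measure (E m)} [IsProbabilityMeasure ν] {y₀ y : E m} {κ s u ρ b : ℝ}

lemma pi_hits_ball_lt_le_exp_of_norm_sub_le (hm : m ≠ 0) (hκ : 0 < κ) (hs : 1 < s)
    (hν : ENNReal.ofReal (κ / s) • volume.restrict (Metric.ball y₀ (2 * u)) ≤ ν) (hρ : 0 ≤ ρ)
    (hM : n * (κ * (ρ ^ m * unitBallVolume m)) = M)
    (hρy : s ^ 4 * ρ ≤ ‖y - y₀‖) (hyu : ‖y - y₀‖ ≤ u) :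
    (Measure.pi fun _ : Fin n => ν) {w | hits (Metric.ball y (‖y - y₀‖ / s ^ 2)) w < M}
      ≤ ENNReal.ofReal (Real.exp (-(((1 - s⁻¹) / 2) ^ 2 *
        (n * (κ / s * ((‖y - y₀‖ / s ^ 2) ^ m * unitBallVolume m)))))) := by
  have hV := unitBallVolume_pos m
  have : 0 < s := one_pos.trans hs
  set t := ‖y - y₀‖
  have ht0 : 0 ≤ t := norm_nonneg _
  have hball : Metric.ball y (t / s ^ 2) ⊆ Metric.ball y₀ (2 * u) := by
    refine Metric.ball_subset_ball' ?_
    rw [dist_eq_norm]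
    linarith [div_le_self ht0 (one_le_pow₀ hs.le : 1 ≤ s ^ 2)]
  have hmass := mul_pow_le_measureReal_ball hm hν (by positivity) hball
  have hρt : s ^ 2 * ρ ≤ t / s ^ 2 := by
    rw [le_div_iff₀ (by positivity)]
    linarith
  have hM_le : (M : ℝ) ≤ s⁻¹ * (n * ν.real (Metric.ball y (t / s ^ 2))) := by
    calc (M : ℝ) ≤ (s ^ 2) ^ m / s ^ 2 * M :=
          le_mul_of_one_le_left M.cast_nonneg ((one_le_div (by positivity)).2
            (le_self_pow₀ (one_le_pow₀ hs.le) hm))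
      _ = s⁻¹ * (n * (κ / s * ((s ^ 2 * ρ) ^ m * unitBallVolume m))) := by
          rw [← hM, mul_pow]
          field_simp
      _ ≤ s⁻¹ * (n * (κ / s * ((t / s ^ 2) ^ m * unitBallVolume m))) := by gcongr
      _ ≤ _ := by gcongr
  have hchernoff := pi_hits_lt_le_exp (ι := Fin n) ν (θ := s⁻¹) (M := M)
    (measurableSet_ball (x := y) (ε := t / s ^ 2)) (by positivity) (inv_lt_one_of_one_lt₀ hs)
    (by rwa [Fintype.card_fin])
  rw [Fintype.card_fin] at hchernoff
  refine hchernoff.trans (ENNReal.ofReal_le_ofReal (Real.exp_le_exp.2 (neg_le_neg ?_)))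
  gcongr

lemma exists_ball_subset_of_lt_norm_sub (hu : 0 < u) (hy : u < ‖y - y₀‖) :
    ∃ v, Metric.ball v (u / 6) ⊆ Metric.ball y₀ (2 * u) ∧
      Metric.ball v (u / 6) ⊆ Metric.ball y (‖y - y₀‖ - 4 * (u / 6)) := by
  set t := ‖y - y₀‖ with ht
  have ht0 : 0 < t := hu.trans hy
  have hut : 0 ≤ 1 - u / t := sub_nonneg.2 ((div_le_one ht0).2 hy.le)
  refine ⟨y₀ + (u / t) • (y - y₀), Metric.ball_subset_ball' ?_, Metric.ball_subset_ball' ?_⟩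
  · rw [dist_eq_norm, add_sub_cancel_left, norm_smul, Real.norm_of_nonneg (by positivity), ← ht,
      div_mul_cancel₀ _ ht0.ne']
    linarith
  · have hsub : y₀ + (u / t) • (y - y₀) - y = -((1 - u / t) • (y - y₀)) := by module
    rw [dist_eq_norm, hsub, norm_neg, norm_smul, Real.norm_of_nonneg hut, ← ht, sub_mul, one_mul,
      div_mul_cancel₀ _ ht0.ne']
    linarith

lemma pi_hits_ball_lt_le_exp_of_lt_norm_sub (hm : m ≠ 0) (hu : 0 < u)
    (hν : ENNReal.ofReal b • volume.restrict (Metric.ball y₀ (2 * u)) ≤ ν)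
    (hM : (M : ℝ) ≤ 1 / 2 * (n * (b * ((u / 6) ^ m * unitBallVolume m)))) (hy : u < ‖y - y₀‖) :
    (Measure.pi fun _ : Fin n => ν) {w | hits (Metric.ball y (‖y - y₀‖ - 4 * (u / 6))) w < M}
      ≤ ENNReal.ofReal (Real.exp (-(((1 - 1 / 2) / 2) ^ 2 *
        (n * (b * ((u / 6) ^ m * unitBallVolume m)))))) := by
  obtain ⟨v, hv₀, hv⟩ := exists_ball_subset_of_lt_norm_sub hu hy
  have hmass := (mul_pow_le_measureReal_ball hm hν (by positivity) hv₀).trans (measureReal_mono hv)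
  have hchernoff := pi_hits_lt_le_exp (ι := Fin n) ν (θ := 1 / 2)
    (measurableSet_ball (x := y) (ε := ‖y - y₀‖ - 4 * (u / 6))) (M := M) (by norm_num)
    (by norm_num) (hM.trans (by rw [Fintype.card_fin]; gcongr))
  rw [Fintype.card_fin] at hchernoff
  refine hchernoff.trans (ENNReal.ofReal_le_ofReal (Real.exp_le_exp.2 (neg_le_neg ?_)))
  gcongr

lemma pi_le_hits_ball_le_exp (hm : m ≠ 0) (hκ : 0 < κ) (hs : 1 < s)
    (hν : ν.restrict (Metric.ball y₀ (2 * u)) ≤ ENNReal.ofReal (s * κ) • volume) (hρ : 0 ≤ ρ)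
    (hM : n * (κ * (ρ ^ m * unitBallVolume m)) = M) (hρu : ρ < u)
    (hy : ‖y - y₀‖ ≤ (s ^ 4)⁻¹ * ρ) :
    (Measure.pi fun _ : Fin n => ν) {w | (M : ℝ) ≤ hits (Metric.ball y (ρ / s ^ 2)) w}
      ≤ ENNReal.ofReal (Real.exp (-(((1 - s⁻¹) / 2) ^ 2 * M))) := by
  have hV := unitBallVolume_pos m
  have : 0 < s := one_pos.trans hs
  have hρs : ρ / s ^ 2 ≤ ρ := div_le_self hρ (one_le_pow₀ hs.le)
  have hyρ : ‖y - y₀‖ ≤ ρ :=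
    hy.trans (mul_le_of_le_one_left hρ (inv_le_one_of_one_le₀ (one_le_pow₀ hs.le)))
  have hball : Metric.closedBall y (ρ / s ^ 2) ⊆ Metric.ball y₀ (2 * u) := by
    refine Metric.closedBall_subset_ball' ?_
    rw [dist_eq_norm]
    linarith
  have hmass : n * ν.real (Metric.ball y (ρ / s ^ 2)) ≤ s⁻¹ * M := by
    calc _ ≤ n * ν.real (Metric.closedBall y (ρ / s ^ 2)) := by
          gcongr
          exacts [measure_ne_top _ _, Metric.ball_subset_closedBall]
      _ ≤ n * (s * κ * ((ρ / s ^ 2) ^ m * unitBallVolume m)) := by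
          gcongr
          exact measureReal_closedBall_le_mul_pow (by positivity) hν (by positivity) hball
      _ = s⁻¹ * (s ^ 2 / (s ^ 2) ^ m * M) := by
          rw [← hM, div_pow]
          field_simp
      _ ≤ s⁻¹ * M := by
          gcongr
          exact mul_le_of_le_one_left M.cast_nonneg ((div_le_one (by positivity)).2
            (le_self_pow₀ (one_le_pow₀ hs.le) hm))
  exact pi_le_hits_le_exp ν measurableSet_ball (by positivity) (inv_lt_one_of_one_lt₀ hs)
    M.cast_nonneg (by rwa [Fintype.card_fin])

end BallProbabilities

section UnusualPoints

variable {m p : ℕ} {ν₀ ν₁ : Measure (E m)} [IsProbabilityMeasure ν₀] [IsProbabilityMeasure ν₁]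
  {M N₁ : ℕ → ℕ} {y₀ : E m} {κ s u b L : ℝ}

lemma MatchingRegime.tendsto_ofReal_mul_inv (h : MatchingRegime M N₁) (a : ℝ) :
    Tendsto (fun N => ENNReal.ofReal (a * (M N : ℝ)⁻¹)) atTop (𝓝 0) := by
  simpa using ENNReal.tendsto_ofReal (((tendsto_inv_atTop_zero.comp
    (tendsto_natCast_atTop_atTop (R := ℝ))).comp h.tendsto_count).const_mul a)

lemma vanishesInLp_hits_sparseSet_of_norm_sub_le (h : MatchingRegime M N₁) (hp : p ≠ 0)
    (hm : m ≠ 0) (hκ : 0 < κ) (hs : 1 < s) (hu : 0 < u)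
    (hν₀ : ENNReal.ofReal (κ / s) • volume.restrict (Metric.ball y₀ (2 * u)) ≤ ν₀)
    (hν₁ : ν₁.restrict (Metric.ball y₀ (2 * u)) ≤ ENNReal.ofReal b • volume) :
    VanishesInLp (fun N => sampleLaw ν₀ ν₁ N (N₁ N)) p fun N z =>
      ENNReal.ofReal (matchScale N (N₁ N) (M N)) * ENNReal.ofReal (hits {y | (z.1, y) ∈
        sparseSet (Metric.closedBall y₀ u \ Metric.ball y₀ (s ^ 4 * matchRadius m κ (M N) N))
          (fun y => ‖y - y₀‖ / s ^ 2) (M N) N} z.2) := by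
  have hV := unitBallVolume_pos m
  have : 0 < s := one_pos.trans hs
  have hs1 : 0 < 1 - s⁻¹ := sub_pos.2 (inv_lt_one_of_one_lt₀ hs)
  have hp0 : (p : ℝ) ≠ 0 := Nat.cast_ne_zero.2 hp
  set a := ((1 - s⁻¹) / 2) ^ 2 * (κ / s * (((s ^ 2) ^ m)⁻¹ * unitBallVolume m)) / p with ha
  have ha0 : 0 < a := by positivity
  refine vanishesInLp_hits_section h hp
    (fun N => measurableSet_sparseSet (measurableSet_closedBall.diff measurableSet_ball)
      (by fun_prop) (M N) N)
    (fun N z hz => hz.1) (rate := fun N y => a * N * ‖y - y₀‖ ^ m)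
    (fun N => by fun_prop) ?_ ?_
  · filter_upwards [h.eventually_ne_zero] with N hN y hy
    refine (measure_mono fun w hw => hw.2).trans ((pi_hits_ball_lt_le_exp_of_norm_sub_le hm hκ hs
      hν₀ (matchRadius_nonneg hκ (M N) N) (mul_matchRadius_pow hm hκ (M N) hN.1)
      (by simpa [dist_eq_norm] using hy.2) (by simpa [dist_eq_norm] using hy.1)).trans_eq ?_)
    congr 3
    rw [ha, div_pow ‖y - y₀‖]
    field_simp
  · refine tendsto_of_tendsto_of_tendsto_of_le_of_le' tendsto_const_nhds
      (h.tendsto_ofReal_mul_inv (b * unitBallVolume m / a))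
      (Eventually.of_forall fun _ => zero_le) ?_
    filter_upwards [h.eventually_ne_zero] with N hN
    have hN0 : (0 : ℝ) < N := Nat.cast_pos.2 (Nat.pos_of_ne_zero hN.1)
    calc _ ≤ ENNReal.ofReal (N / M N) * ∫⁻ y,
          ENNReal.ofReal (Real.exp (-(a * N * ‖y - y₀‖ ^ m))) ∂(ENNReal.ofReal b • volume) := by
          gcongr
          exact (Measure.restrict_mono_set _
            (Set.sdiff_subset.trans (Metric.closedBall_subset_ball (by linarith)))).trans hν₁
      _ = _ := by
          rw [lintegral_smul_measure, lintegral_exp_neg_mul_norm_sub_pow hm (by positivity),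
            smul_eq_mul, mul_left_comm, ← ENNReal.ofReal_mul (by positivity), mul_comm,
            ← ENNReal.ofReal_mul (by positivity)]
          congr 1
          field_simp

lemma vanishesInLp_hits_sparseSet_of_lt_norm_sub (h : MatchingRegime M N₁) (hp : p ≠ 0)
    (hm : m ≠ 0) (hb : 0 < b) (hu : 0 < u)
    (hν₀ : ENNReal.ofReal b • volume.restrict (Metric.ball y₀ (2 * u)) ≤ ν₀) :
    VanishesInLp (fun N => sampleLaw ν₀ ν₁ N (N₁ N)) p fun N z =>
      ENNReal.ofReal (matchScale N (N₁ N) (M N)) * ENNReal.ofReal (hits {y | (z.1, y) ∈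
        sparseSet (Metric.closedBall y₀ u)ᶜ (fun y => ‖y - y₀‖ - 4 * (u / 6)) (M N) N} z.2) := by
  have hV := unitBallVolume_pos m
  have hp0 : (p : ℝ) ≠ 0 := Nat.cast_ne_zero.2 hp
  set q := b * ((u / 6) ^ m * unitBallVolume m) with hq
  have : 0 < q := by positivity
  set a := (1 / 4) ^ 2 * q / p with ha
  have ha0 : 0 < a := by positivity
  refine vanishesInLp_hits_section h hp
    (fun N => measurableSet_sparseSet measurableSet_closedBall.compl (by fun_prop) (M N) N)
    (fun N z hz => hz.1) (rate := fun N _ => a * N) (fun N => measurable_const) ?_ ?_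
  · filter_upwards [h.eventually_ne_zero,
      h.tendsto_fraction.eventually_le_const (show 0 < 1 / 2 * q by positivity)] with N hN hMN y hy
    rw [div_le_iff₀ (Nat.cast_pos.2 (Nat.pos_of_ne_zero hN.1))] at hMN
    refine (measure_mono fun w hw => hw.2).trans ((pi_hits_ball_lt_le_exp_of_lt_norm_sub hm hu hν₀
      (by linarith) (by simpa [dist_eq_norm] using hy)).trans_eq ?_)
    congr 3
    rw [ha, hq]
    field_simp
    ring
  · refine tendsto_of_tendsto_of_tendsto_of_le_of_le' tendsto_const_nhds
      (h.tendsto_ofReal_mul_inv a⁻¹) (Eventually.of_forall fun _ => zero_le) ?_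
    filter_upwards [h.eventually_ne_zero] with N hN
    have hN0 : (0 : ℝ) < N := Nat.cast_pos.2 (Nat.pos_of_ne_zero hN.1)
    have hexp : Real.exp (-(a * N)) ≤ (a * N)⁻¹ := by
      rw [Real.exp_neg]
      gcongr
      linarith [Real.add_one_le_exp (a * N)]
    calc _ ≤ ENNReal.ofReal (N / M N) * ENNReal.ofReal (a * N)⁻¹ := by
          rw [lintegral_const, Measure.restrict_apply_univ]
          gcongr
          exact (mul_le_of_le_one_right' prob_le_one).trans (ENNReal.ofReal_le_ofReal hexp)
      _ = _ := by
          rw [← ENNReal.ofReal_mul (by positivity)]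
          congr 1
          field_simp

lemma vanishesInLp_hits_crowdedSet (h : MatchingRegime M N₁) (hp : p ≠ 0)
    (hm : m ≠ 0) (hκ : 0 < κ) (hs : 1 < s) (hu : 0 < u)
    (hν₀ : ν₀.restrict (Metric.ball y₀ (2 * u)) ≤ ENNReal.ofReal (s * κ) • volume)
    (hL : Tendsto (fun N : ℕ => N / M N *
      ν₁.real (Metric.closedBall y₀ ((s ^ 4)⁻¹ * matchRadius m κ (M N) N))) atTop (𝓝 L)) :
    VanishesInLp (fun N => sampleLaw ν₀ ν₁ N (N₁ N)) p fun N z =>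
      ENNReal.ofReal (matchScale N (N₁ N) (M N)) * ENNReal.ofReal (hits {y | (z.1, y) ∈
        crowdedSet (Metric.closedBall y₀ ((s ^ 4)⁻¹ * matchRadius m κ (M N) N))
          (fun _ => matchRadius m κ (M N) N / s ^ 2) (M N) N} z.2) := by
  have : (0 : ℝ) < p := Nat.cast_pos.2 (Nat.pos_of_ne_zero hp)
  have hs1 : 0 < 1 - s⁻¹ := sub_pos.2 (inv_lt_one_of_one_lt₀ hs)
  set a := ((1 - s⁻¹) / 2) ^ 2 / p with ha
  have ha0 : 0 < a := by positivity
  refine vanishesInLp_hits_section h hp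
    (fun N => measurableSet_crowdedSet Metric.isClosed_closedBall.measurableSet measurable_const
      (M N) N)
    (fun N z hz => hz.1) (rate := fun N _ => a * M N) (fun N => measurable_const) ?_ ?_
  · filter_upwards [h.eventually_ne_zero, (h.tendsto_matchRadius hm).eventually_lt_const hu]
      with N hN hρu y hy
    refine (measure_mono fun w hw => hw.2).trans ((pi_le_hits_ball_le_exp hm hκ hs hν₀
      (matchRadius_nonneg hκ (M N) N) (mul_matchRadius_pow hm hκ (M N) hN.1) hρu
      (by rwa [← dist_eq_norm])).trans_eq ?_)
    congr 3
    rw [ha]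
    field_simp
  · have hexp : Tendsto (fun N => Real.exp (-(a * M N))) atTop (𝓝 0) :=
      Real.tendsto_exp_neg_atTop_nhds_zero.comp
        ((tendsto_natCast_atTop_atTop.comp h.tendsto_count).const_mul_atTop ha0)
    have hlim := ENNReal.tendsto_ofReal (hL.mul hexp)
    rw [mul_zero, ENNReal.ofReal_zero] at hlim
    refine hlim.congr fun N => ?_
    rw [lintegral_const, Measure.restrict_apply_univ, mul_assoc, ENNReal.ofReal_mul (by positivity),
      ENNReal.ofReal_mul (by positivity), ofReal_measureReal (measure_ne_top _ _), mul_comm (ν₁ _)]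

end UnusualPoints

section RandomRadius

variable {m k p : ℕ} {y₀ : E m} {a u b θ : ℝ}

/-- The largest excess, over `i ≥ 1`, of the number of points of a sample in the ball of radius
`min (2 ^ i * a) u` around `y₀` over twice the expected number of points in a ball of radius
`2 ^ i * a` under the constant density `b`. -/
noncomputable def ballExcess (y₀ : E m) (b a u : ℝ) (y : Fin k → E m) : ℝ≥0∞ :=
  ⨆ i : ℕ, ENNReal.ofReal (hits (Metric.closedBall y₀ (min (2 ^ (i + 1) * a) u)) y -
    2 * (k * (b * ((2 ^ (i + 1) * a) ^ m * unitBallVolume m))))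

lemma measurable_ballExcess : Measurable (ballExcess y₀ b a u : (Fin k → E m) → ℝ≥0∞) :=
  .iSup fun _ => ((measurable_hits measurableSet_closedBall).sub_const _).ennreal_ofReal

lemma ofReal_hits_closedBall_le_add_ballExcess (hb : 0 ≤ b) {R : ℝ} (ha : 0 < a) (haR : a ≤ R)
    (hRu : R ≤ u) (y : Fin k → E m) :
    ENNReal.ofReal (hits (Metric.closedBall y₀ R) y) ≤
      ENNReal.ofReal (2 * (b * (2 ^ m * unitBallVolume m))) * (k * ENNReal.ofReal R ^ m) +
        ballExcess y₀ b a u y := by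
  have hV := unitBallVolume_pos m
  obtain ⟨i, hiR, hRi⟩ := exists_nat_pow_near ((one_le_div ha).2 haR) one_lt_two
  rw [le_div_iff₀ ha] at hiR
  rw [div_lt_iff₀ ha] at hRi
  have hradius : 2 ^ (i + 1) * a ≤ 2 * R := by
    rw [pow_succ]
    linarith
  calc ENNReal.ofReal (hits (Metric.closedBall y₀ R) y)
      ≤ ENNReal.ofReal (2 * (k * (b * ((2 ^ (i + 1) * a) ^ m * unitBallVolume m)))) +
          ENNReal.ofReal (hits (Metric.closedBall y₀ (min (2 ^ (i + 1) * a) u)) y -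
            2 * (k * (b * ((2 ^ (i + 1) * a) ^ m * unitBallVolume m)))) := by
        refine le_trans (ENNReal.ofReal_le_ofReal ?_) ENNReal.ofReal_add_le
        rw [add_sub_cancel]
        exact hits_le_hits fun j hj => Metric.closedBall_subset_closedBall (le_min hRi.le hRu) hj
    _ ≤ ENNReal.ofReal (2 * (k * (b * ((2 * R) ^ m * unitBallVolume m)))) +
          ballExcess y₀ b a u y := by
        gcongr
        exact le_iSup_of_le i le_rfl
    _ = _ := by
        rw [← ENNReal.ofReal_natCast, ← ENNReal.ofReal_pow (ha.le.trans haR),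
          ← ENNReal.ofReal_mul (by positivity), ← ENNReal.ofReal_mul (by positivity)]
        congr 2
        ring

lemma four_mul_le_expected_hits_dyadic (hm : m ≠ 0)
    (hmean : 4 ≤ k * (b * (a ^ m * unitBallVolume m))) (i : ℕ) :
    4 * ((i : ℝ) + 1) ≤ k * (b * ((2 ^ (i + 1) * a) ^ m * unitBallVolume m)) := by
  have hi : (i : ℝ) + 1 ≤ (2 ^ (i + 1)) ^ m :=
    calc (i : ℝ) + 1 ≤ 2 ^ (i + 1) := by exact_mod_cast Nat.lt_two_pow_self.le
      _ ≤ _ := le_self_pow₀ (one_le_pow₀ one_le_two) hm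
  calc 4 * ((i : ℝ) + 1)
      ≤ k * (b * (a ^ m * unitBallVolume m)) * (2 ^ (i + 1)) ^ m := by gcongr
    _ = _ := by ring

/-- The supremum is bounded by the sum over `i`: the expected number of hits at least doubles with
each `i`, so the terms decay geometrically by the Chernoff bound. -/
lemma lintegral_ballExcess_pow_le {ν : Measure (E m)} [IsProbabilityMeasure ν] (hm : m ≠ 0)
    (hp : p ≠ 0) (hb : 0 ≤ b) (ha : 0 ≤ a) (hu : 0 < u)
    (hν : ν.restrict (Metric.ball y₀ (2 * u)) ≤ ENNReal.ofReal b • volume)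
    (hmean : 4 ≤ k * (b * (a ^ m * unitBallVolume m))) :
    ∫⁻ y, ballExcess y₀ b a u y ^ p ∂(Measure.pi fun _ : Fin k => ν)
      ≤ ∑' i : ℕ, ENNReal.ofReal (p.factorial * Real.exp (-(i + 1))) := by
  have hV := unitBallVolume_pos m
  set x : ℕ → (Fin k → E m) → ℝ≥0∞ := fun i y => ENNReal.ofReal
    (hits (Metric.closedBall y₀ (min (2 ^ (i + 1) * a) u)) y -
      2 * (k * (b * ((2 ^ (i + 1) * a) ^ m * unitBallVolume m))))
  calc _ ≤ ∫⁻ y, ∑' i, x i y ^ p ∂(Measure.pi fun _ : Fin k => ν) := by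
        refine lintegral_mono fun y => ?_
        rw [ballExcess, ENNReal.iSup_pow_of_ne_zero hp]
        exact iSup_le fun i => ENNReal.le_tsum (f := fun i => x i y ^ p) i
    _ = ∑' i, ∫⁻ y, x i y ^ p ∂(Measure.pi fun _ : Fin k => ν) :=
        lintegral_tsum fun i => (((measurable_hits
          measurableSet_closedBall).sub_const _).ennreal_ofReal.pow_const p).aemeasurable
    _ ≤ _ := by
        refine ENNReal.tsum_le_tsum fun i => ?_
        have hmass : ν.real (Metric.closedBall y₀ (min (2 ^ (i + 1) * a) u))
            ≤ b * ((2 ^ (i + 1) * a) ^ m * unitBallVolume m) :=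
          calc _ ≤ b * (min (2 ^ (i + 1) * a) u ^ m * unitBallVolume m) :=
                measureReal_closedBall_le_mul_pow hb hν (by positivity)
                  (Metric.closedBall_subset_ball ((min_le_right _ _).trans_lt (by linarith)))
            _ ≤ _ := by
                gcongr
                exact min_le_left _ _
        refine (lintegral_hits_excess_pow_le ν measurableSet_closedBall hp
          (by rw [Fintype.card_fin]; gcongr)).trans (ENNReal.ofReal_le_ofReal ?_)
        gcongr
        linarith [four_mul_le_expected_hits_dyadic hm hmean i]

lemma vanishesInLp_ballExcess {ν₁ : Measure (E m)} [IsProbabilityMeasure ν₁] {M N₁ : ℕ → ℕ}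
    (h : MatchingRegime M N₁) (hp : p ≠ 0) (hm : m ≠ 0) {κ : ℝ} (hκ : 0 < κ) (hb : 0 < b)
    (ha : 0 < a) (hu : 0 < u)
    (hν₁ : ν₁.restrict (Metric.ball y₀ (2 * u)) ≤ ENNReal.ofReal b • volume) :
    VanishesInLp (fun N => Measure.pi fun _ : Fin (N₁ N) => ν₁) p fun N y =>
      ENNReal.ofReal (matchScale N (N₁ N) (M N)) *
        ballExcess y₀ b (a * matchRadius m κ (M N) N) u y := by
  refine ⟨fun N => (measurable_ballExcess.const_mul _).aemeasurable, ?_⟩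
  set K := ∑' i : ℕ, ENNReal.ofReal (p.factorial * Real.exp (-(i + 1)))
  have hK_top : K ≠ ∞ := by
    have hsum : Summable fun i : ℕ => p.factorial * Real.exp (-((i : ℝ) + 1)) := by
      simpa only [Nat.cast_succ] using
        ((summable_nat_add_iff 1).2 Real.summable_exp_neg_nat).mul_left (p.factorial : ℝ)
    exact hsum.tsum_ofReal_ne_top
  have hlim := ENNReal.Tendsto.mul_const (b := K) (((ENNReal.continuous_pow p).tendsto _).comp
    (ENNReal.tendsto_ofReal h.tendsto_matchScale)) (Or.inr hK_top)
  rw [ENNReal.ofReal_zero, zero_pow hp, zero_mul] at hlim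
  refine tendsto_of_tendsto_of_tendsto_of_le_of_le' tendsto_const_nhds hlim
    (Eventually.of_forall fun _ => zero_le) ?_
  filter_upwards [h.eventually_ne_zero,
    h.tendsto_mean.eventually_ge_atTop (4 * κ / (b * a ^ m))] with N hN hmean
  simp_rw [mul_pow]
  rw [lintegral_const_mul' _ _ (by finiteness)]
  refine mul_le_mul_right (lintegral_ballExcess_pow_le hm hp hb.le
    (mul_nonneg ha.le (matchRadius_nonneg hκ _ _)) hu hν₁ ?_) _
  have hN0 : (N : ℝ) ≠ 0 := Nat.cast_ne_zero.2 hN.1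
  rw [← mul_matchRadius_pow hm hκ (M N) hN.1, div_le_iff₀ (by positivity)] at hmean
  refine le_of_mul_le_mul_right (hmean.trans_eq ?_) hκ
  rw [mul_pow]
  field_simp

/-- The points at a distance between `a` and `u` from `y₀` whose distance from `y₀` is at most
`θ * D`: the places where an estimation error of size `D` may change which points are matched. -/
def errorAnnulus (y₀ : E m) (θ a u : ℝ) (D : ℝ≥0∞) : Set (E m) :=
  {y | a < ‖y - y₀‖ ∧ ‖y - y₀‖ ≤ u ∧ ENNReal.ofReal (‖y - y₀‖ / θ) ≤ D}

lemma ofReal_hits_errorAnnulus_le (hb : 0 ≤ b) (ha : 0 < a) (hu : 0 ≤ u) (hθ : 0 < θ) (D : ℝ≥0∞)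
    (y : Fin k → E m) :
    ENNReal.ofReal (hits (errorAnnulus y₀ θ a u D) y) ≤
      ENNReal.ofReal (2 * (b * ((2 * θ) ^ m * unitBallVolume m))) * (k * D ^ m) +
        ballExcess y₀ b a u y := by
  have hV := unitBallVolume_pos m
  set R := (min (ENNReal.ofReal θ * D) (ENNReal.ofReal u)).toReal
  have hRD : ENNReal.ofReal R = min (ENNReal.ofReal θ * D) (ENNReal.ofReal u) :=
    ENNReal.ofReal_toReal (ne_top_of_le_ne_top ENNReal.ofReal_ne_top (min_le_right _ _))
  have hRu : R ≤ u := (ENNReal.ofReal_le_ofReal_iff hu).1 (hRD.trans_le (min_le_right _ _))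
  have hsub : ∀ z ∈ errorAnnulus y₀ θ a u D, ‖z - y₀‖ ≤ R := fun z ⟨_, hzu, hzD⟩ => by
    rw [← ENNReal.ofReal_le_ofReal_iff ENNReal.toReal_nonneg, hRD]
    refine le_min ?_ (ENNReal.ofReal_le_ofReal hzu)
    rw [← mul_div_cancel₀ ‖z - y₀‖ hθ.ne', ENNReal.ofReal_mul hθ.le]
    gcongr
  rcases lt_or_ge R a with hRa | haR
  · have hempty : hits (errorAnnulus y₀ θ a u D) y ≤ hits ∅ y :=
      hits_le_hits fun j hj => absurd hj.1 ((hsub _ hj).trans hRa.le).not_gt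
    rw [ENNReal.ofReal_of_nonpos (hempty.trans_eq (by simp [hits]))]
    exact zero_le
  · calc _ ≤ ENNReal.ofReal (hits (Metric.closedBall y₀ R) y) :=
          ENNReal.ofReal_le_ofReal (hits_le_hits fun j hj => mem_closedBall_iff_norm.2 (hsub _ hj))
      _ ≤ _ := ofReal_hits_closedBall_le_add_ballExcess hb ha haR hRu y
      _ ≤ ENNReal.ofReal (2 * (b * (2 ^ m * unitBallVolume m))) *
            (k * (ENNReal.ofReal θ * D) ^ m) + ballExcess y₀ b a u y := by
          gcongr
          exact hRD.trans_le (min_le_left _ _)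
      _ = _ := by
          rw [mul_pow (ENNReal.ofReal θ), ← ENNReal.ofReal_pow hθ.le, mul_left_comm (k : ℝ≥0∞),
            ← mul_assoc, ← ENNReal.ofReal_mul (by positivity)]
          ring_nf

end RandomRadius

section OrderStatistic

variable {M n : ℕ}

lemma orderStat_lt_iff (hM : M ≠ 0) (hMn : M ≤ n) (a : Fin n → ℝ) (t : ℝ) :
    orderStat M a < t ↔ M ≤ hits (Set.Iio t) a := by
  classical
  have hlt : M - 1 < n := by omega
  have hsort := Tuple.lt_card_lt_iff_apply_lt_of_monotone (j := ⟨M - 1, hlt⟩) (a := t)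
    (Tuple.monotone_sort a)
  have hcard : (Finset.univ.filter fun i => (a ∘ Tuple.sort a) i < t).card
      = (Finset.univ.filter fun i => a i ∈ Set.Iio t).card :=
    Finset.card_equiv (Tuple.sort a) fun i => by simp
  rw [hcard, Function.comp_apply] at hsort
  rw [orderStat, dif_pos hlt, ← hsort, hits_eq_card_filter, Nat.cast_le]
  change M - 1 < _ ↔ _
  omega

lemma measurable_orderStat : Measurable fun a : Fin n → ℝ => orderStat M a := by
  by_cases hlt : M - 1 < n
  · refine measurable_of_Iio fun t => ?_
    have hpre : (fun a : Fin n → ℝ => orderStat M a) ⁻¹' Set.Iio t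
        = {a | ((M - 1 + 1 : ℕ) : ℝ) ≤ hits (Set.Iio t) a} := by
      ext a
      rw [Set.mem_ofPred_eq, ← orderStat_lt_iff (by omega) (by omega), Set.mem_preimage,
        Set.mem_Iio]
      simp only [orderStat, Nat.add_sub_cancel]
    rw [hpre]
    exact measurableSet_le measurable_const (measurable_hits measurableSet_Iio)
  · simp only [orderStat, dif_neg hlt]
    exact measurable_const

end OrderStatistic

section Catchment

variable {d m n k M : ℕ} {𝒳 𝒵 : Set (E d)} {φ g : E d → E m} {ε θ : ℝ} {D : ℝ≥0∞}
  {xs : Fin n → E d} {x z : E d}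

lemma mem_catchment_iff (hM : M ≠ 0) (hMn : M ≤ n) :
    z ∈ catchment 𝒵 M xs g x ↔
      z ∈ 𝒵 ∧ hits (Metric.ball (g z) ‖g x - g z‖) (fun i => g (xs i)) < M := by
  have hball : hits (Set.Iio ‖g x - g z‖) (fun i => ‖g (xs i) - g z‖)
      = hits (Metric.ball (g z) ‖g x - g z‖) fun i => g (xs i) :=
    le_antisymm (hits_le_hits fun _ => mem_ball_iff_norm.2)
      (hits_le_hits fun _ => mem_ball_iff_norm.1)
  rw [← not_le (b := hits _ _), ← hball, ← orderStat_lt_iff hM hMn, not_lt]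
  rfl

/-- The error of the transformation `g`, an estimate of `φ`, has small increments at all scales
above `D`: between points whose images under `φ` have a distance of at most `T > D`, the
increment of `g - φ` is at most `ε * T`. The threshold `D` is an extended number, so that it may
be infinite. -/
def IncrementBound (𝒳 : Set (E d)) (φ g : E d → E m) (ε : ℝ) (D : ℝ≥0∞) : Prop :=
  ∀ s ∈ 𝒳, ∀ t ∈ 𝒳, ∀ T : ℝ, D < ENNReal.ofReal T → ‖φ s - φ t‖ ≤ T →
    ‖(g s - φ s) - (g t - φ t)‖ ≤ ε * T

lemma abs_norm_sub_sub_norm_sub_le (s t : E d) :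
    |‖g s - g t‖ - ‖φ s - φ t‖| ≤ ‖(g s - φ s) - (g t - φ t)‖ := by
  rw [sub_sub_sub_comm]
  exact abs_norm_sub_norm_le _ _

namespace IncrementBound

variable {s t : E d}

lemma norm_sub_le (hg : IncrementBound 𝒳 φ g ε D) (hs : s ∈ 𝒳) (ht : t ∈ 𝒳) {T : ℝ}
    (hD : D < ENNReal.ofReal T) (hT : ‖φ s - φ t‖ ≤ T) : ‖g s - g t‖ ≤ ‖φ s - φ t‖ + ε * T := by
  linarith [(abs_le.1 ((abs_norm_sub_sub_norm_sub_le s t).trans (hg s hs t ht T hD hT))).2]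

lemma le_norm_sub (hg : IncrementBound 𝒳 φ g ε D) (hs : s ∈ 𝒳) (ht : t ∈ 𝒳)
    (hD : D < ENNReal.ofReal ‖φ s - φ t‖) : (1 - ε) * ‖φ s - φ t‖ ≤ ‖g s - g t‖ := by
  linarith [(abs_le.1 ((abs_norm_sub_sub_norm_sub_le s t).trans (hg s hs t ht _ hD le_rfl))).1]

end IncrementBound

lemma hits_ball_div_lt_of_mem_catchment (hM : M ≠ 0) (hMn : M ≤ n) (hθ : 1 ≤ θ)
    (hε : 1 + ε ≤ θ * (1 - ε)) (hg : IncrementBound 𝒳 φ g ε D) (hx : x ∈ 𝒳) (hz : z ∈ 𝒳)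
    (hxs : ∀ i, xs i ∈ 𝒳) (hD : D < ENNReal.ofReal (‖φ z - φ x‖ / θ))
    (hmem : z ∈ catchment 𝒵 M xs g x) :
    hits (Metric.ball (φ z) (‖φ z - φ x‖ / θ)) (fun i => φ (xs i)) < M := by
  rw [norm_sub_rev] at hD ⊢
  have hθ0 : 0 < θ := one_pos.trans_le hθ
  have hscale : ‖φ x - φ z‖ / θ * (1 + ε) ≤ (1 - ε) * ‖φ x - φ z‖ := by
    rw [div_mul_eq_mul_div, div_le_iff₀ hθ0]
    nlinarith [mul_le_mul_of_nonneg_left hε (norm_nonneg (φ x - φ z))]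
  have hgx : (1 - ε) * ‖φ x - φ z‖ ≤ ‖g x - g z‖ := hg.le_norm_sub hx hz
    (hD.trans_le (ENNReal.ofReal_le_ofReal (div_le_self (norm_nonneg _) hθ)))
  refine (hits_le_hits fun i hi => ?_).trans_lt ((mem_catchment_iff hM hMn).1 hmem).2
  rw [mem_ball_iff_norm] at hi ⊢
  linarith [hg.norm_sub_le (hxs i) hz hD hi.le]

lemma hits_ball_sub_lt_of_mem_catchment (hM : M ≠ 0) (hMn : M ≤ n) {e : ℝ}
    (hg : ∀ t ∈ 𝒳, ‖g t - φ t‖ ≤ e) (hx : x ∈ 𝒳) (hz : z ∈ 𝒳) (hxs : ∀ i, xs i ∈ 𝒳)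
    (hmem : z ∈ catchment 𝒵 M xs g x) :
    hits (Metric.ball (φ z) (‖φ z - φ x‖ - 4 * e)) (fun i => φ (xs i)) < M := by
  rw [norm_sub_rev]
  have hdist : ∀ s ∈ 𝒳, |‖g s - g z‖ - ‖φ s - φ z‖| ≤ 2 * e := fun s hs =>
    (abs_norm_sub_sub_norm_sub_le s z).trans
      ((norm_sub_le _ _).trans (by linarith [hg s hs, hg z hz]))
  refine (hits_le_hits fun i hi => ?_).trans_lt ((mem_catchment_iff hM hMn).1 hmem).2
  rw [mem_ball_iff_norm] at hi ⊢
  linarith [(abs_le.1 (hdist x hx)).1, (abs_le.1 (hdist _ (hxs i))).2]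

lemma mem_catchment_of_hits_ball_lt (hM : M ≠ 0) (hMn : M ≤ n) (hθ : 1 ≤ θ)
    (hε : 1 + ε ≤ θ * (1 - ε)) (hg : IncrementBound 𝒳 φ g ε D) (hx : x ∈ 𝒳) (hz : z ∈ 𝒳)
    (hz' : z ∈ 𝒵) (hxs : ∀ i, xs i ∈ 𝒳) {T : ℝ} (hD : D < ENNReal.ofReal (T / θ))
    (hzx : ‖φ z - φ x‖ ≤ T / θ) (h : hits (Metric.ball (φ z) T) (fun i => φ (xs i)) < M) :
    z ∈ catchment 𝒵 M xs g x := by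
  rw [norm_sub_rev] at hzx
  have hθ0 : 0 < θ := one_pos.trans_le hθ
  have hTθ : 0 < T / θ := ENNReal.ofReal_pos.1 (zero_le.trans_lt hD)
  have hT : T / θ ≤ T := div_le_self (by simpa [div_mul_cancel₀ _ hθ0.ne'] using
    (mul_pos hTθ hθ0).le) hθ
  have hscale : T / θ * (1 + ε) ≤ (1 - ε) * T := by
    calc T / θ * (1 + ε) ≤ T / θ * (θ * (1 - ε)) := by gcongr
      _ = (1 - ε) * T := by field_simp
  have hε1 : 0 ≤ 1 - ε := by nlinarith
  refine (mem_catchment_iff hM hMn).2 ⟨hz', (hits_le_hits fun i hi => ?_).trans_lt h⟩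
  rw [mem_ball_iff_norm] at hi ⊢
  by_contra! hfar
  have hlow := hg.le_norm_sub (hxs i) hz (hD.trans_le (ENNReal.ofReal_le_ofReal (hT.trans hfar)))
  linarith [hg.norm_sub_le hx hz hD hzx, mul_le_mul_of_nonneg_left hfar hε1]

end Catchment

section MatchCount

variable {d m n k M : ℕ} {𝒳 𝒵 : Set (E d)} {φ g : E d → E m} {ε s a u : ℝ} {D : ℝ≥0∞}
  {xs : Fin n → E d} {zs : Fin k → E d} {x : E d}

lemma matchCount_eq_hits : matchCount 𝒵 M xs zs g x = hits (catchment 𝒵 M xs g x) zs := rfl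

lemma matchCount_le (hM : M ≠ 0) (hMn : M ≤ n) (hs : 1 ≤ s) (hε : 1 + ε ≤ s ^ 2 * (1 - ε))
    (hg : IncrementBound 𝒳 φ g ε D) (hgu : ∀ t ∈ 𝒳, ‖g t - φ t‖ ≤ u / 6)
    (hx : x ∈ 𝒳) (hxs : ∀ i, xs i ∈ 𝒳) (hzs : ∀ j, zs j ∈ 𝒳) (a : ℝ) :
    matchCount 𝒵 M xs zs g x ≤
      hits (Metric.closedBall (φ x) a) (fun j => φ (zs j)) +
      hits {y | (fun i => φ (xs i), y) ∈ sparseSet (Metric.closedBall (φ x) u \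
        Metric.ball (φ x) a) (fun y => ‖y - φ x‖ / s ^ 2) M n} (fun j => φ (zs j)) +
      hits {y | (fun i => φ (xs i), y) ∈ sparseSet (Metric.closedBall (φ x) u)ᶜ
        (fun y => ‖y - φ x‖ - 4 * (u / 6)) M n} (fun j => φ (zs j)) +
      hits (errorAnnulus (φ x) (s ^ 2) a u D) (fun j => φ (zs j)) := by
  rw [matchCount_eq_hits]
  refine le_trans (hits_le_hits fun j hj => ?_) ((hits_union_le _ _ _).trans
    (add_le_add_left ((hits_union_le _ _ _).trans (add_le_add_left (hits_union_le _ _ _) _)) _))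
  simp only [Set.mem_union, sparseSet, errorAnnulus, Set.mem_ofPred_eq, Set.mem_sdiff,
    Set.mem_compl_iff, mem_closedBall_iff_norm, mem_ball_iff_norm, not_le, not_lt]
  rcases le_or_gt ‖φ (zs j) - φ x‖ a with hin | hout
  · exact .inl (.inl (.inl hin))
  rcases lt_or_ge u ‖φ (zs j) - φ x‖ with hfar | hnear
  · exact .inl (.inr ⟨hfar, hits_ball_sub_lt_of_mem_catchment hM hMn hgu hx (hzs j) hxs hj⟩)
  rcases lt_or_ge D (ENNReal.ofReal (‖φ (zs j) - φ x‖ / s ^ 2)) with hD | hD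
  · exact .inl (.inl (.inr ⟨⟨hnear, hout.le⟩,
      hits_ball_div_lt_of_mem_catchment hM hMn (one_le_pow₀ hs) hε hg hx (hzs j) hxs hD hj⟩))
  · exact .inr ⟨hout, hnear, hD⟩

lemma hits_closedBall_le_matchCount_add (hM : M ≠ 0) (hMn : M ≤ n) (hs : 1 ≤ s)
    (hε : 1 + ε ≤ s ^ 2 * (1 - ε)) (hg : IncrementBound 𝒳 φ g ε D) (hx : x ∈ 𝒳)
    (hxs : ∀ i, xs i ∈ 𝒳) (hzs : ∀ j, zs j ∈ 𝒳) (hzs' : ∀ j, zs j ∈ 𝒵) {ρ : ℝ}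
    (hD : D < ENNReal.ofReal ((s ^ 4)⁻¹ * ρ)) :
    hits (Metric.closedBall (φ x) ((s ^ 4)⁻¹ * ρ)) (fun j => φ (zs j)) ≤
      matchCount 𝒵 M xs zs g x +
      hits {y | (fun i => φ (xs i), y) ∈ crowdedSet (Metric.closedBall (φ x) ((s ^ 4)⁻¹ * ρ))
        (fun _ => ρ / s ^ 2) M n} (fun j => φ (zs j)) := by
  rw [matchCount_eq_hits]
  have hradius : (s ^ 4)⁻¹ * ρ = ρ / s ^ 2 / s ^ 2 := by
    rw [div_div, ← pow_add, inv_mul_eq_div]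
  have hcover : ∀ j, φ (zs j) ∈ Metric.closedBall (φ x) ((s ^ 4)⁻¹ * ρ) →
      zs j ∈ catchment 𝒵 M xs g x ∪ φ ⁻¹' {y | (fun i => φ (xs i), y) ∈
        crowdedSet (Metric.closedBall (φ x) ((s ^ 4)⁻¹ * ρ)) (fun _ => ρ / s ^ 2) M n} := by
    intro j hj
    rcases lt_or_ge (hits (Metric.ball (φ (zs j)) (ρ / s ^ 2)) fun i => φ (xs i)) (M : ℝ)
      with hsparse | hcrowded
    · rw [mem_closedBall_iff_norm, hradius] at hj
      exact .inl (mem_catchment_of_hits_ball_lt hM hMn (one_le_pow₀ hs) hε hg hx (hzs j) (hzs' j)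
        hxs (hradius ▸ hD) hj hsparse)
    · exact .inr ⟨hj, hcrowded⟩
  exact (hits_le_hits (y := fun j => φ (zs j)) hcover).trans (hits_union_le _ _ _)

end MatchCount

section RatioEstimate

variable {d m n k M : ℕ} {𝒵 : Set (E d)} {g : E d → E m} {xs : Fin n → E d} {zs : Fin k → E d}
  {x : E d}

lemma ratioEstimate_eq_matchScale_mul :
    ratioEstimate 𝒵 M xs zs g x = matchScale n k M * matchCount 𝒵 M xs zs g x := by
  rw [ratioEstimate, matchScale]
  ring

lemma ratioEstimate_nonneg : 0 ≤ ratioEstimate 𝒵 M xs zs g x := by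
  rw [ratioEstimate_eq_matchScale_mul]
  exact mul_nonneg (matchScale_nonneg n k M) (hits_nonneg _ _)

lemma ratioEstimate_le : ratioEstimate 𝒵 M xs zs g x ≤ n / M := by
  rcases eq_or_ne k 0 with rfl | hk
  · simp only [ratioEstimate, Nat.cast_zero, div_zero, zero_mul]
    positivity
  · rw [ratioEstimate_eq_matchScale_mul, ← matchScale_mul hk]
    gcongr
    · exact matchScale_nonneg n k M
    · exact (hits_le_card _ _).trans_eq (by rw [Fintype.card_fin])

end RatioEstimate

section Deterministic

variable {d m n k M : ℕ} {𝒳 𝒵 : Set (E d)} {φ g : E d → E m} {ε s u b κ L : ℝ} {D : ℝ≥0∞}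
  {xs : Fin n → E d} {zs : Fin k → E d} {x : E d}

lemma ofReal_natCast_div_le (n M : ℕ) : ENNReal.ofReal ((n : ℝ) / M) ≤ (n : ℝ≥0∞) / M := by
  rcases Nat.eq_zero_or_pos M with rfl | hM
  · simp only [Nat.cast_zero, div_zero, ENNReal.ofReal_zero, zero_le]
  · rw [ENNReal.ofReal_div_of_pos (Nat.cast_pos.2 hM), ENNReal.ofReal_natCast,
      ENNReal.ofReal_natCast]

lemma ofReal_ratioEstimate_le (hM : M ≠ 0) (hMn : M ≤ n) (hk : k ≠ 0) (hs : 1 ≤ s)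
    (hε : 1 + ε ≤ s ^ 2 * (1 - ε)) (hg : IncrementBound 𝒳 φ g ε D)
    (hgu : ∀ t ∈ 𝒳, ‖g t - φ t‖ ≤ u / 6) (hx : x ∈ 𝒳) (hxs : ∀ i, xs i ∈ 𝒳)
    (hzs : ∀ j, zs j ∈ 𝒳) (hb : 0 ≤ b) {a : ℝ} (ha : 0 < a) (hu : 0 ≤ u) (L : ℝ) :
    ENNReal.ofReal (ratioEstimate 𝒵 M xs zs g x) ≤
      ENNReal.ofReal |matchScale n k M * hits (Metric.closedBall (φ x) a) (fun j => φ (zs j)) - L| +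
      ENNReal.ofReal (matchScale n k M) * ENNReal.ofReal (hits {y | (fun i => φ (xs i), y) ∈
        sparseSet (Metric.closedBall (φ x) u \ Metric.ball (φ x) a)
          (fun y => ‖y - φ x‖ / s ^ 2) M n} fun j => φ (zs j)) +
      ENNReal.ofReal (matchScale n k M) * ENNReal.ofReal (hits {y | (fun i => φ (xs i), y) ∈
        sparseSet (Metric.closedBall (φ x) u)ᶜ (fun y => ‖y - φ x‖ - 4 * (u / 6)) M n}
          fun j => φ (zs j)) +
      ENNReal.ofReal (2 * (b * ((2 * s ^ 2) ^ m * unitBallVolume m))) * (n / M * D ^ m) +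
      ENNReal.ofReal (matchScale n k M) * ballExcess (φ x) b a u (fun j => φ (zs j)) +
      ENNReal.ofReal L := by
  have hcount := matchCount_le (𝒵 := 𝒵) hM hMn hs hε hg hgu hx hxs hzs a
  have hscale := matchScale_nonneg n k M
  rw [ratioEstimate_eq_matchScale_mul, ENNReal.ofReal_mul hscale]
  set c := ENNReal.ofReal (matchScale n k M)
  set y := fun j => φ (zs j)
  have hball : c * ENNReal.ofReal (hits (Metric.closedBall (φ x) a) y) ≤
      ENNReal.ofReal |matchScale n k M * hits (Metric.closedBall (φ x) a) y - L| +
        ENNReal.ofReal L := by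
    rw [← ENNReal.ofReal_mul hscale]
    refine le_trans (ENNReal.ofReal_le_ofReal ?_) ENNReal.ofReal_add_le
    linarith [le_abs_self (matchScale n k M * hits (Metric.closedBall (φ x) a) y - L)]
  have hannulus : c * ENNReal.ofReal (hits (errorAnnulus (φ x) (s ^ 2) a u D) y) ≤
      ENNReal.ofReal (2 * (b * ((2 * s ^ 2) ^ m * unitBallVolume m))) * (n / M * D ^ m) +
        c * ballExcess (φ x) b a u y := by
    grw [ofReal_hits_errorAnnulus_le hb ha hu (by positivity) D y, mul_add, mul_left_comm,
      ← mul_assoc c, ofReal_matchScale_mul hk, ofReal_natCast_div_le]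
  grw [hcount, ENNReal.ofReal_add_le, ENNReal.ofReal_add_le, ENNReal.ofReal_add_le, mul_add,
    mul_add, mul_add, hball, hannulus]
  exact le_of_eq (by ring)

lemma ofReal_le_mul_pow_of_matchRadius_le (hm : m ≠ 0) (hκ : 0 < κ) (hL : 0 ≤ L) (hn : n ≠ 0)
    (hM : M ≠ 0) {a : ℝ} (ha : 0 < a) (hD : ENNReal.ofReal (a⁻¹ * matchRadius m κ M n) ≤ D) :
    ENNReal.ofReal L ≤ ENNReal.ofReal (L * (κ * unitBallVolume m * a ^ m)) * (n / M * D ^ m) := by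
  have hV := unitBallVolume_pos m
  have hρ := matchRadius_nonneg (m := m) hκ M n
  have hcalib := mul_matchRadius_pow hm hκ M hn
  have hL_eq : L = L * (κ * unitBallVolume m * a ^ m) *
      (n / M * (a⁻¹ * matchRadius m κ M n) ^ m) := by
    rw [mul_pow, inv_pow]
    field_simp
    linear_combination (-L) * hcalib
  conv_lhs => rw [hL_eq]
  rw [ENNReal.ofReal_mul (by positivity), ENNReal.ofReal_mul (p := (n : ℝ) / M) (by positivity),
    ENNReal.ofReal_pow (by positivity)]
  grw [hD, ofReal_natCast_div_le]

lemma ofReal_le_ratioEstimate_add (hm : m ≠ 0) (hκ : 0 < κ) (hL : 0 ≤ L) (hM : M ≠ 0) (hMn : M ≤ n)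
    (hs : 1 ≤ s) (hε : 1 + ε ≤ s ^ 2 * (1 - ε)) (hg : IncrementBound 𝒳 φ g ε D) (hx : x ∈ 𝒳)
    (hxs : ∀ i, xs i ∈ 𝒳) (hzs : ∀ j, zs j ∈ 𝒳) (hzs' : ∀ j, zs j ∈ 𝒵) :
    ENNReal.ofReal L ≤
      ENNReal.ofReal |matchScale n k M * hits (Metric.closedBall (φ x)
        ((s ^ 4)⁻¹ * matchRadius m κ M n)) (fun j => φ (zs j)) - L| +
      ENNReal.ofReal (matchScale n k M) * ENNReal.ofReal (hits {y | (fun i => φ (xs i), y) ∈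
        crowdedSet (Metric.closedBall (φ x) ((s ^ 4)⁻¹ * matchRadius m κ M n))
          (fun _ => matchRadius m κ M n / s ^ 2) M n} fun j => φ (zs j)) +
      ENNReal.ofReal (L * (κ * unitBallVolume m * (s ^ 4) ^ m)) * (n / M * D ^ m) +
      ENNReal.ofReal (ratioEstimate 𝒵 M xs zs g x) := by
  rcases lt_or_ge D (ENNReal.ofReal ((s ^ 4)⁻¹ * matchRadius m κ M n)) with hD | hD
  · have hscale := matchScale_nonneg n k M
    have hcount := hits_closedBall_le_matchCount_add hM hMn hs hε hg hx hxs hzs hzs' hD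
    rw [ratioEstimate_eq_matchScale_mul, ENNReal.ofReal_mul hscale]
    set c := ENNReal.ofReal (matchScale n k M)
    set y := fun j => φ (zs j)
    set B := Metric.closedBall (φ x) ((s ^ 4)⁻¹ * matchRadius m κ M n)
    set F := {y | (fun i => φ (xs i), y) ∈ crowdedSet B _ M n}
    have hball : ENNReal.ofReal L ≤ ENNReal.ofReal |matchScale n k M * hits B y - L| +
        c * ENNReal.ofReal (hits B y) := by
      rw [← ENNReal.ofReal_mul hscale, ← ENNReal.ofReal_add (abs_nonneg _)
        (mul_nonneg hscale (hits_nonneg _ _))]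
      exact ENNReal.ofReal_le_ofReal (by linarith [neg_abs_le (matchScale n k M * hits B y - L)])
    have hcover : c * ENNReal.ofReal (hits B y) ≤
        c * ENNReal.ofReal (matchCount 𝒵 M xs zs g x) + c * ENNReal.ofReal (hits F y) := by
      grw [hcount, ENNReal.ofReal_add_le, mul_add]
    grw [hball, hcover, ← le_self_add (a := ENNReal.ofReal _ + c * ENNReal.ofReal (hits F y))]
    exact le_of_eq (by ring)
  · have hs4 : 0 < s ^ 4 := by positivity
    have hn : n ≠ 0 := (Nat.pos_of_ne_zero hM |>.trans_le hMn).ne'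
    calc _ ≤ _ := ofReal_le_mul_pow_of_matchRadius_le hm hκ hL hn hM hs4 hD
      _ ≤ _ := le_add_self
      _ ≤ _ := le_self_add

end Deterministic

section SampleBounds

variable {Ω : Type*} [MeasurableSpace Ω] {d m p : ℕ}

/-- The errors of the random transformations `g N` as estimates of `φ` are controlled by random
variables `D N` and `S N`: the errors are at most `S N` in the sup norm and, where `S N ≤ 1`, have
increments of slope at most `ε` at all scales above `D N`. The random variables are small in the
sense that, for samples of size `N` and `M N` matches, `N / M N` times `(D N) ^ m` and times the
indicator of `S N > e` converge to `0` in `Lᵖ`. -/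
structure ErrorControl (P : Measure Ω) (M : ℕ → ℕ) (𝒳 : Set (E d)) (φ : E d → E m)
    (g : ℕ → Ω → E d → E m) (p : ℕ) (ε : ℝ) (D S : ℕ → Ω → ℝ≥0∞) : Prop where
  vanishesInLp_threshold : VanishesInLp (fun _ => P) p fun N ω => (N / M N) * D N ω ^ m
  vanishesInLp_indicator : ∀ e : ℝ, 0 < e → VanishesInLp (fun _ => P) p fun N ω =>
    (N / M N) * {ω | ENNReal.ofReal e < S N ω}.indicator 1 ω
  incrementBound : ∀ N, ∀ᵐ ω ∂P, S N ω ≤ 1 → IncrementBound 𝒳 φ (g N ω) ε (D N ω)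
  enorm_sub_le : ∀ N, ∀ᵐ ω ∂P, ∀ t ∈ 𝒳, ‖g N ω t - φ t‖ₑ ≤ S N ω

/-- The transformed points `φ (X i)` and `φ (Z j)` form two independent samples, with the laws `ν₀`
and `ν₁`. The points themselves lie in `𝒳` and in `𝒵 ⊆ 𝒳`. -/
structure IsTwoSample (P : Measure Ω) (X Z : ℕ → Ω → E d) (𝒳 𝒵 : Set (E d)) (φ : E d → E m)
    (ν₀ ν₁ : Measure (E m)) : Prop where
  measurePreserving : ∀ N k, MeasurePreserving
    (fun ω => ((fun i : Fin N => φ (X i ω)), fun j : Fin k => φ (Z j ω))) P (sampleLaw ν₀ ν₁ N k)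
  subset : 𝒵 ⊆ 𝒳
  ae_mem_left : ∀ᵐ ω ∂P, ∀ i, X i ω ∈ 𝒳
  ae_mem_right : ∀ᵐ ω ∂P, ∀ j, Z j ω ∈ 𝒵

variable {P : Measure Ω} {X Z : ℕ → Ω → E d} {𝒳 𝒵 : Set (E d)} {φ : E d → E m}
  {ν₀ ν₁ : Measure (E m)} [IsProbabilityMeasure ν₀] [IsProbabilityMeasure ν₁] {x : E d}
  {M N₁ : ℕ → ℕ} {g : ℕ → Ω → E d → E m} {κ s ε u b L : ℝ} {D S : ℕ → Ω → ℝ≥0∞}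

lemma IsTwoSample.measurePreserving_right (hXZ : IsTwoSample P X Z 𝒳 𝒵 φ ν₀ ν₁) (k : ℕ) :
    MeasurePreserving (fun ω => fun j : Fin k => φ (Z j ω)) P (Measure.pi fun _ => ν₁) :=
  (measurePreserving_snd (μ := Measure.pi fun _ : Fin 0 => ν₀)).comp (hXZ.measurePreserving 0 k)

/-- The density ratio estimate that uses the random transformation `g N` and the first `N` points
`X i` and `N₁ N` points `Z j`. -/
noncomputable def sampleRatioEstimate (X Z : ℕ → Ω → E d) (M N₁ : ℕ → ℕ) (𝒵 : Set (E d))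
    (g : ℕ → Ω → E d → E m) (x : E d) (N : ℕ) (ω : Ω) : ℝ :=
  ratioEstimate 𝒵 (M N) (fun i : Fin N => X i ω) (fun j : Fin (N₁ N) => Z j ω) (g N ω) x

lemma exists_vanishesInLp_sampleRatioEstimate_le (h : MatchingRegime M N₁) (hp : p ≠ 0)
    (hm : m ≠ 0) (hκ : 0 < κ) (hs : 1 < s) (hε : 1 + ε ≤ s ^ 2 * (1 - ε)) (hu : 0 < u) (hu1 : u ≤ 1)
    (hb : 0 < b)
    (hν₀ : ENNReal.ofReal (κ / s) • volume.restrict (Metric.ball (φ x) (2 * u)) ≤ ν₀)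
    (hν₁ : ν₁.restrict (Metric.ball (φ x) (2 * u)) ≤ ENNReal.ofReal b • volume)
    (hL : Tendsto (fun N : ℕ => N / M N *
      ν₁.real (Metric.closedBall (φ x) (s ^ 4 * matchRadius m κ (M N) N))) atTop (𝓝 L))
    (hXZ : IsTwoSample P X Z 𝒳 𝒵 φ ν₀ ν₁) (hx : x ∈ 𝒳) (hg : ErrorControl P M 𝒳 φ g p ε D S) :
    ∃ G : ℕ → Ω → ℝ≥0∞, VanishesInLp (fun _ => P) p G ∧ ∀ᶠ N in atTop, ∀ᵐ ω ∂P,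
      ENNReal.ofReal (sampleRatioEstimate X Z M N₁ 𝒵 g x N ω) ≤ G N ω + ENNReal.ofReal L := by
  have hlaw := fun N => hXZ.measurePreserving N (N₁ N)
  have hlaw₁ := fun N => hXZ.measurePreserving_right (N₁ N)
  have hball := (vanishesInLp_abs_hits_sub h hp
    (fun _ => Metric.isClosed_closedBall.measurableSet) hL).comp_measurePreserving hlaw₁
  have hnear := (vanishesInLp_hits_sparseSet_of_norm_sub_le h hp hm hκ hs hu hν₀
    hν₁).comp_measurePreserving hlaw
  have hfar := (vanishesInLp_hits_sparseSet_of_lt_norm_sub (ν₁ := ν₁) h hp hm (by positivity) hu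
    hν₀).comp_measurePreserving hlaw
  have hannulus := hg.vanishesInLp_threshold.const_mul
    (c := ENNReal.ofReal (2 * (b * ((2 * s ^ 2) ^ m * unitBallVolume m)))) ENNReal.ofReal_ne_top
  have hexcess := (vanishesInLp_ballExcess h hp hm hκ hb (by positivity : 0 < s ^ 4) hu
    hν₁).comp_measurePreserving hlaw₁
  have hlarge := hg.vanishesInLp_indicator (u / 6) (by positivity)
  refine ⟨_, ((((hball.add hnear).add hfar).add hannulus).add hexcess).add hlarge, ?_⟩
  filter_upwards [h.eventually_ne_zero, h.eventually_le] with N ⟨hN, hM, hk⟩ hMN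
  filter_upwards [hXZ.ae_mem_left, hXZ.ae_mem_right, hg.incrementBound N, hg.enorm_sub_le N]
    with ω hX hZ hinc hsup
  rcases lt_or_ge (ENNReal.ofReal (u / 6)) (S N ω) with hS | hS
  · have hmem : ω ∈ {ω | ENNReal.ofReal (u / 6) < S N ω} := hS
    calc ENNReal.ofReal (sampleRatioEstimate X Z M N₁ 𝒵 g x N ω) ≤ N / M N :=
          (ENNReal.ofReal_le_ofReal ratioEstimate_le).trans (ofReal_natCast_div_le N (M N))
      _ = N / M N * {ω | ENNReal.ofReal (u / 6) < S N ω}.indicator 1 ω := by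
          rw [Set.indicator_of_mem hmem, Pi.one_apply, mul_one]
      _ ≤ _ := le_add_self
      _ ≤ _ := le_self_add
  · have hgu : ∀ t ∈ 𝒳, ‖g N ω t - φ t‖ ≤ u / 6 := fun t ht => by
      rw [← ENNReal.ofReal_le_ofReal_iff (by positivity), ofReal_norm]
      exact (hsup t ht).trans hS
    have hS1 : S N ω ≤ 1 := hS.trans (ENNReal.ofReal_le_one.2 (by linarith))
    exact (ofReal_ratioEstimate_le hM hMN hk hs.le hε (hinc hS1) hgu hx (fun i => hX i)
      (fun j => hXZ.subset (hZ j)) hb.le (mul_pos (by positivity) (matchRadius_pos hm hκ hN hM))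
      hu.le L).trans (add_le_add_left le_self_add _)

lemma exists_vanishesInLp_le_sampleRatioEstimate (h : MatchingRegime M N₁) (hp : p ≠ 0)
    (hm : m ≠ 0) (hκ : 0 < κ) (hs : 1 < s) (hε : 1 + ε ≤ s ^ 2 * (1 - ε)) (hu : 0 < u)
    (hL₀ : 0 ≤ L)
    (hν₀ : ν₀.restrict (Metric.ball (φ x) (2 * u)) ≤ ENNReal.ofReal (s * κ) • volume)
    (hL : Tendsto (fun N : ℕ => N / M N *
      ν₁.real (Metric.closedBall (φ x) ((s ^ 4)⁻¹ * matchRadius m κ (M N) N))) atTop (𝓝 L))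
    (hXZ : IsTwoSample P X Z 𝒳 𝒵 φ ν₀ ν₁) (hx : x ∈ 𝒳) (hg : ErrorControl P M 𝒳 φ g p ε D S) :
    ∃ G : ℕ → Ω → ℝ≥0∞, VanishesInLp (fun _ => P) p G ∧ ∀ᶠ N in atTop, ∀ᵐ ω ∂P,
      ENNReal.ofReal L ≤ G N ω + ENNReal.ofReal (sampleRatioEstimate X Z M N₁ 𝒵 g x N ω) := by
  have hball := (vanishesInLp_abs_hits_sub h hp
    (fun _ => Metric.isClosed_closedBall.measurableSet) hL).comp_measurePreserving
    fun N => hXZ.measurePreserving_right (N₁ N)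
  have hcrowded := (vanishesInLp_hits_crowdedSet h hp hm hκ hs hu hν₀ hL).comp_measurePreserving
    fun N => hXZ.measurePreserving N (N₁ N)
  have hthreshold := hg.vanishesInLp_threshold.const_mul
    (c := ENNReal.ofReal (L * (κ * unitBallVolume m * (s ^ 4) ^ m))) ENNReal.ofReal_ne_top
  have hlarge := (hg.vanishesInLp_indicator 1 one_pos).const_mul (c := ENNReal.ofReal L)
    ENNReal.ofReal_ne_top
  refine ⟨_, ((hball.add hcrowded).add hthreshold).add hlarge, ?_⟩
  filter_upwards [h.eventually_ne_zero, h.eventually_le] with N ⟨_, hM, _⟩ hMN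
  filter_upwards [hXZ.ae_mem_left, hXZ.ae_mem_right, hg.incrementBound N] with ω hX hZ hinc
  rcases lt_or_ge (ENNReal.ofReal 1) (S N ω) with hS | hS
  · have hone : (1 : ℝ≥0∞) ≤ N / M N := by
      rw [ENNReal.le_div_iff_mul_le (by simp [hM]) (by simp), one_mul]
      exact_mod_cast hMN
    have hmem : ω ∈ {ω | ENNReal.ofReal 1 < S N ω} := hS
    calc ENNReal.ofReal L
        ≤ ENNReal.ofReal L * (N / M N * {ω | ENNReal.ofReal 1 < S N ω}.indicator 1 ω) := by
          rw [Set.indicator_of_mem hmem, Pi.one_apply, mul_one]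
          exact le_mul_of_one_le_right zero_le hone
      _ ≤ _ := le_add_self
      _ ≤ _ := le_self_add
  · exact (ofReal_le_ratioEstimate_add hm hκ hL₀ hM hMN hs.le hε
      (hinc (by rwa [ENNReal.ofReal_one] at hS)) hx (fun i => hX i)
      (fun j => hXZ.subset (hZ j)) fun j => hZ j).trans (add_le_add_left le_self_add _)

end SampleBounds

section LocalBounds

variable {m : ℕ} {f : E m → ℝ} {y : E m} {b : ℝ}

lemma eventually_forall_mem_ball {Q : E m → Prop} (h : ∀ᶠ z in 𝓝 y, Q z) :
    ∀ᶠ u : ℝ in 𝓝[>] 0, ∀ z ∈ Metric.ball y (2 * u), Q z := by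
  obtain ⟨t, ht, hball⟩ := Metric.eventually_nhds_iff_ball.1 h
  filter_upwards [Ioo_mem_nhdsGT (half_pos ht)] with u hu z hz
  exact hball z (Metric.ball_subset_ball (by linarith [hu.2]) hz)

lemma eventually_smul_restrict_ball_le_withDensity (hf : ContinuousAt f y) (hb : b < f y) :
    ∀ᶠ u : ℝ in 𝓝[>] 0, ENNReal.ofReal b • volume.restrict (Metric.ball y (2 * u)) ≤
      volume.withDensity fun z => ENNReal.ofReal (f z) :=
  (eventually_forall_mem_ball ((hf.eventually_const_lt hb).mono fun _ => le_of_lt)).mono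
    fun _ => smul_restrict_le_withDensity Metric.isOpen_ball.measurableSet

lemma eventually_restrict_ball_withDensity_le_smul (hf : ContinuousAt f y) (hb : f y < b) :
    ∀ᶠ u : ℝ in 𝓝[>] 0, (volume.withDensity fun z => ENNReal.ofReal (f z)).restrict
      (Metric.ball y (2 * u)) ≤ ENNReal.ofReal b • volume :=
  (eventually_forall_mem_ball ((hf.eventually_lt_const hb).mono fun _ => le_of_lt)).mono
    fun _ => restrict_withDensity_le_smul Metric.isOpen_ball.measurableSet

end LocalBounds

section Consistency

variable {Ω : Type*} [MeasurableSpace Ω] {P : Measure Ω} [IsProbabilityMeasure P] {d m p : ℕ}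
  {X Z : ℕ → Ω → E d} {𝒳 𝒵 : Set (E d)} {φ : E d → E m} {x : E d} {f₀ f₁ : E m → ℝ}
  [IsProbabilityMeasure (volume.withDensity fun y => ENNReal.ofReal (f₀ y))]
  [IsProbabilityMeasure (volume.withDensity fun y => ENNReal.ofReal (f₁ y))]
  {M N₁ : ℕ → ℕ} {g : ℕ → Ω → E d → E m}

lemma exists_pos_one_add_le_sq_mul_one_sub {s : ℝ} (hs : 1 < s) :
    ∃ ε, 0 < ε ∧ 1 + ε ≤ s ^ 2 * (1 - ε) := by
  have hs2 : 1 < s ^ 2 := one_lt_pow₀ hs two_ne_zero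
  refine ⟨(s ^ 2 - 1) / (s ^ 2 + 1), div_pos (by linarith) (by positivity), le_of_eq ?_⟩
  field_simp
  ring

lemma tendsto_lintegral_ofReal_sampleRatioEstimate_sub_pow (h : MatchingRegime M N₁) (hp : p ≠ 0)
    (hm : m ≠ 0) (hpos : 0 < f₀ (φ x)) (hf₁ : 0 ≤ f₁ (φ x)) (hc₀ : ContinuousAt f₀ (φ x))
    (hc₁ : ContinuousAt f₁ (φ x))
    (hXZ : IsTwoSample P X Z 𝒳 𝒵 φ (volume.withDensity fun y => ENNReal.ofReal (f₀ y))
      (volume.withDensity fun y => ENNReal.ofReal (f₁ y))) (hx : x ∈ 𝒳)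
    (hg : ∀ ε : ℝ, 0 < ε → ∃ D S, ErrorControl P M 𝒳 φ g p ε D S) :
    Tendsto (fun N => ∫⁻ ω, ENNReal.ofReal
      (sampleRatioEstimate X Z M N₁ 𝒵 g x N ω - f₁ (φ x) / f₀ (φ x)) ^ p ∂P) atTop (𝓝 0) := by
  set r := f₁ (φ x) / f₀ (φ x)
  have hr0 : 0 ≤ r := by positivity
  refine tendsto_lintegral_pow_of_forall_le_add hp fun η hη => ?_
  have hnear : ∀ᶠ s : ℝ in 𝓝[>] 1, ENNReal.ofReal (r * (s ^ 4) ^ m - r) < η := by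
    have hcont : Continuous fun s : ℝ => ENNReal.ofReal (r * (s ^ 4) ^ m - r) :=
      ENNReal.continuous_ofReal.comp (by fun_prop)
    exact (hcont.continuousAt.eventually_lt_const (by simpa using hη)).filter_mono
      nhdsWithin_le_nhds
  obtain ⟨s, hsη, hs : 1 < s⟩ := (hnear.and self_mem_nhdsWithin).exists
  obtain ⟨ε, hε0, hε⟩ := exists_pos_one_add_le_sq_mul_one_sub hs
  obtain ⟨D, S, hDS⟩ := hg ε hε0
  obtain ⟨u, ⟨⟨hν₀, hν₁⟩, hu1⟩, hu : 0 < u⟩ :=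
    ((((eventually_smul_restrict_ball_le_withDensity hc₀ (div_lt_self hpos hs)).and
      (eventually_restrict_ball_withDensity_le_smul hc₁ (lt_add_one _))).and
      ((eventually_le_nhds one_pos).filter_mono nhdsWithin_le_nhds)).and self_mem_nhdsWithin).exists
  obtain ⟨G, hG, hle⟩ := exists_vanishesInLp_sampleRatioEstimate_le h hp hm hpos hs hε hu hu1
    (by positivity) hν₀ hν₁
    (h.tendsto_measureReal_closedBall hm hpos hf₁ hc₁ (by positivity)) hXZ hx hDS
  refine ⟨G, hG, hle.mono fun N hN => hN.mono fun ω hω => ?_⟩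
  calc ENNReal.ofReal (sampleRatioEstimate X Z M N₁ 𝒵 g x N ω - r)
      = ENNReal.ofReal (sampleRatioEstimate X Z M N₁ 𝒵 g x N ω) - ENNReal.ofReal r :=
        ENNReal.ofReal_sub _ hr0
    _ ≤ G N ω + ENNReal.ofReal (r * (s ^ 4) ^ m) - ENNReal.ofReal r := tsub_le_tsub_right hω _
    _ ≤ G N ω + (ENNReal.ofReal (r * (s ^ 4) ^ m) - ENNReal.ofReal r) := add_tsub_le_assoc
    _ ≤ G N ω + η := by
        rw [← ENNReal.ofReal_sub _ hr0]
        gcongr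

lemma tendsto_lintegral_ofReal_sub_sampleRatioEstimate_pow (h : MatchingRegime M N₁) (hp : p ≠ 0)
    (hm : m ≠ 0) (hpos : 0 < f₀ (φ x)) (hf₁ : 0 ≤ f₁ (φ x)) (hc₀ : ContinuousAt f₀ (φ x))
    (hc₁ : ContinuousAt f₁ (φ x))
    (hXZ : IsTwoSample P X Z 𝒳 𝒵 φ (volume.withDensity fun y => ENNReal.ofReal (f₀ y))
      (volume.withDensity fun y => ENNReal.ofReal (f₁ y))) (hx : x ∈ 𝒳)
    (hg : ∀ ε : ℝ, 0 < ε → ∃ D S, ErrorControl P M 𝒳 φ g p ε D S) :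
    Tendsto (fun N => ∫⁻ ω, ENNReal.ofReal
      (f₁ (φ x) / f₀ (φ x) - sampleRatioEstimate X Z M N₁ 𝒵 g x N ω) ^ p ∂P) atTop (𝓝 0) := by
  set r := f₁ (φ x) / f₀ (φ x)
  have : 0 ≤ r := by positivity
  refine tendsto_lintegral_pow_of_forall_le_add hp fun η hη => ?_
  have hnear : ∀ᶠ s : ℝ in 𝓝[>] 1, ENNReal.ofReal (r - r * ((s ^ 4)⁻¹) ^ m) < η := by
    have hcont : ContinuousAt (fun s : ℝ => ENNReal.ofReal (r - r * ((s ^ 4)⁻¹) ^ m)) 1 :=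
      ENNReal.continuous_ofReal.continuousAt.comp (by fun_prop (disch := norm_num))
    exact (hcont.eventually_lt_const (by simpa using hη)).filter_mono nhdsWithin_le_nhds
  obtain ⟨s, hsη, hs : 1 < s⟩ := (hnear.and self_mem_nhdsWithin).exists
  obtain ⟨ε, hε0, hε⟩ := exists_pos_one_add_le_sq_mul_one_sub hs
  obtain ⟨D, S, hDS⟩ := hg ε hε0
  obtain ⟨u, hν₀, hu : 0 < u⟩ := ((eventually_restrict_ball_withDensity_le_smul hc₀
    (lt_mul_of_one_lt_left hpos hs)).and self_mem_nhdsWithin).exists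
  obtain ⟨G, hG, hle⟩ := exists_vanishesInLp_le_sampleRatioEstimate h hp hm hpos hs hε hu
    (by positivity) hν₀ (h.tendsto_measureReal_closedBall hm hpos hf₁ hc₁ (by positivity)) hXZ hx
    hDS
  refine ⟨G, hG, hle.mono fun N hN => hN.mono fun ω hω => ?_⟩
  have hL : 0 ≤ r * ((s ^ 4)⁻¹) ^ m := by positivity
  calc ENNReal.ofReal (r - sampleRatioEstimate X Z M N₁ 𝒵 g x N ω)
      = ENNReal.ofReal r - ENNReal.ofReal (sampleRatioEstimate X Z M N₁ 𝒵 g x N ω) :=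
        ENNReal.ofReal_sub _ ratioEstimate_nonneg
    _ ≤ G N ω + (ENNReal.ofReal r - ENNReal.ofReal (r * ((s ^ 4)⁻¹) ^ m)) := by
        rw [tsub_le_iff_right, add_right_comm]
        exact le_add_tsub.trans (add_le_add_left hω _)
    _ ≤ G N ω + η := by
        rw [← ENNReal.ofReal_sub _ hL]
        gcongr

theorem tendsto_lintegral_abs_sampleRatioEstimate_sub_pow (h : MatchingRegime M N₁) (hp : p ≠ 0)
    (hm : m ≠ 0) (hpos : 0 < f₀ (φ x)) (hf₁ : 0 ≤ f₁ (φ x)) (hc₀ : ContinuousAt f₀ (φ x))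
    (hc₁ : ContinuousAt f₁ (φ x))
    (hXZ : IsTwoSample P X Z 𝒳 𝒵 φ (volume.withDensity fun y => ENNReal.ofReal (f₀ y))
      (volume.withDensity fun y => ENNReal.ofReal (f₁ y))) (hx : x ∈ 𝒳)
    (hg : ∀ ε : ℝ, 0 < ε → ∃ D S, ErrorControl P M 𝒳 φ g p ε D S)
    (hmeas : ∀ N, Measurable (sampleRatioEstimate X Z M N₁ 𝒵 g x N)) :
    Tendsto (fun N => ∫⁻ ω, ENNReal.ofReal
      |sampleRatioEstimate X Z M N₁ 𝒵 g x N ω - f₁ (φ x) / f₀ (φ x)| ^ p ∂P) atTop (𝓝 0) := by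
  have hsum := (tendsto_lintegral_ofReal_sampleRatioEstimate_sub_pow h hp hm hpos hf₁ hc₀ hc₁
    hXZ hx hg).add (tendsto_lintegral_ofReal_sub_sampleRatioEstimate_pow h hp hm hpos hf₁ hc₀ hc₁
    hXZ hx hg)
  rw [add_zero] at hsum
  refine hsum.congr fun N => ?_
  simp_rw [ofReal_abs_pow_eq_add hp, neg_sub]
  rw [lintegral_add_left (((hmeas N).sub_const _).ennreal_ofReal.pow_const p)]

end Consistency

section LayerCake

variable {Ω : Type*} [MeasurableSpace Ω] {P : Measure Ω} {m p : ℕ} {Y D : Ω → ℝ≥0∞}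

lemma lintegral_mul_measure_eq_top_of_measure_eq_top_ne_zero (hY : P {ω | Y ω = ∞} ≠ 0) (p : ℕ) :
    ∫⁻ u in Set.Ioi (0 : ℝ), ENNReal.ofReal (u ^ p) * P {ω | ENNReal.ofReal u < Y ω} = ∞ := by
  refine top_unique ?_
  calc (∞ : ℝ≥0∞) = ∫⁻ _ in Set.Ioi (1 : ℝ), P {ω | Y ω = ∞} := by
        rw [setLIntegral_const, Real.volume_Ioi, ENNReal.mul_top hY]
    _ ≤ ∫⁻ u in Set.Ioi (1 : ℝ), ENNReal.ofReal (u ^ p) * P {ω | ENNReal.ofReal u < Y ω} := by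
        refine setLIntegral_mono' measurableSet_Ioi fun u (hu : 1 < u) => ?_
        rw [← one_mul (P {ω | Y ω = ∞})]
        refine mul_le_mul' (ENNReal.one_le_ofReal.2 (one_le_pow₀ hu.le))
          (measure_mono fun ω (hω : Y ω = ∞) => ?_)
        exact ENNReal.ofReal_lt_top.trans_eq hω.symm
    _ ≤ _ := lintegral_mono_set (Set.Ioi_subset_Ioi zero_le_one)

lemma lintegral_pow_eq_lintegral_mul_measure_lt (hp : p ≠ 0) (hY : AEMeasurable Y P) :
    ∫⁻ ω, Y ω ^ p ∂P = p * ∫⁻ u in Set.Ioi (0 : ℝ),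
      ENNReal.ofReal (u ^ (p - 1)) * P {ω | ENNReal.ofReal u < Y ω} := by
  by_cases htop : P {ω | Y ω = ∞} = 0
  · have hYtop : ∀ᵐ ω ∂P, Y ω ≠ ∞ := by simpa [ae_iff] using htop
    have hcake := lintegral_rpow_eq_lintegral_meas_lt_mul P (f := fun ω => (Y ω).toReal)
      (ae_of_all _ fun _ => ENNReal.toReal_nonneg) hY.ennreal_toReal
      (Nat.cast_pos.2 (Nat.pos_of_ne_zero hp))
    have hpow : ∫⁻ ω, Y ω ^ p ∂P = ∫⁻ ω, ENNReal.ofReal ((Y ω).toReal ^ (p : ℝ)) ∂P := by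
      refine lintegral_congr_ae (hYtop.mono fun ω hω => ?_)
      simp only [Real.rpow_natCast, ENNReal.ofReal_pow ENNReal.toReal_nonneg,
        ENNReal.ofReal_toReal hω]
    rw [hpow, hcake, ENNReal.ofReal_natCast]
    congr 1
    refine setLIntegral_congr_fun measurableSet_Ioi fun u (hu : 0 < u) => ?_
    have hexp : u ^ ((p : ℝ) - 1) = u ^ (p - 1) := by
      rw [← Real.rpow_natCast, Nat.cast_pred (Nat.pos_of_ne_zero hp)]
    have hset : {ω | u < (Y ω).toReal} =ᵐ[P] {ω | ENNReal.ofReal u < Y ω} :=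
      hYtop.mono fun ω hω => propext (ENNReal.ofReal_lt_iff_lt_toReal hu.le hω).symm
    simp only [hexp, measure_congr hset, mul_comm]
  · rw [lintegral_mul_measure_eq_top_of_measure_eq_top_ne_zero htop,
      ENNReal.mul_top (Nat.cast_ne_zero.2 hp)]
    refine lintegral_eq_top_of_measure_eq_top_ne_zero (hY.pow_const p) ?_
    simpa [ENNReal.pow_eq_top_iff, hp] using htop

lemma lintegral_pow_le_of_measure_lt_le (hm : m ≠ 0) (hp : p ≠ 0) (hD : AEMeasurable D P)
    {T : ℝ → ℝ≥0∞} (hT : ∀ u, 0 < u → P {ω | ENNReal.ofReal u < D ω} ≤ T u) :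
    ∫⁻ ω, (D ω ^ m) ^ p ∂P ≤ p *
      ∫⁻ u in Set.Ioi (0 : ℝ), ENNReal.ofReal (u ^ (p - 1)) * T (u ^ (1 / (m : ℝ))) := by
  rw [lintegral_pow_eq_lintegral_mul_measure_lt hp (hD.pow_const m)]
  refine mul_le_mul_right (setLIntegral_mono' measurableSet_Ioi fun u (hu : 0 < u) =>
    mul_le_mul_right ((measure_mono fun ω hω => ?_).trans (hT _ (Real.rpow_pos_of_pos hu _))) _) _
  have hroot : ENNReal.ofReal (u ^ (1 / (m : ℝ))) ^ m = ENNReal.ofReal u := by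
    rw [← ENNReal.ofReal_pow (by positivity), one_div, Real.rpow_inv_natCast_pow hu.le hm]
  rw [Set.mem_ofPred_eq, ← ENNReal.pow_lt_pow_left_iff hm, hroot]
  exact hω

end LayerCake

section FirstBelow

variable {Ω : Type*} [MeasurableSpace Ω] {P : Measure Ω} {F : ℝ → ℝ≥0∞} {e : ℝ≥0∞}

/-- The infimum of the positive arguments at which `F` is at most `e`. Only rational arguments are
taken, which makes no difference if `F` is antitone, so that measurability is preserved. -/
noncomputable def firstBelow (F : ℝ → ℝ≥0∞) (e : ℝ≥0∞) : ℝ≥0∞ :=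
  ⨅ q : {q : ℚ // 0 < q}, if F (q : ℚ) ≤ e then ENNReal.ofReal (q : ℚ) else ∞

lemma exists_le_of_firstBelow_lt {T : ℝ} (h : firstBelow F e < ENNReal.ofReal T) :
    ∃ u : ℝ, 0 < u ∧ u ≤ T ∧ F u ≤ e := by
  obtain ⟨⟨q, hq⟩, hlt⟩ := iInf_lt_iff.1 h
  split_ifs at hlt with hF
  · have hq' : (0 : ℝ) < q := Rat.cast_pos.2 hq
    exact ⟨q, hq', ((ENNReal.ofReal_lt_ofReal_iff_of_nonneg hq'.le).1 hlt).le, hF⟩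
  · exact absurd hlt not_top_lt

lemma firstBelow_le (hF : Antitone F) {u : ℝ} (hu : 0 < u) (h : F u ≤ e) :
    firstBelow F e ≤ ENNReal.ofReal u := by
  refine le_of_forall_gt_imp_ge_of_dense fun a ha => ?_
  obtain rfl | hatop := eq_or_ne a ∞
  · exact le_top
  rw [← ENNReal.ofReal_toReal hatop] at ha ⊢
  obtain ⟨q, huq, hqa⟩ := exists_rat_btwn ((ENNReal.ofReal_lt_ofReal_iff_of_nonneg hu.le).1 ha)
  refine (iInf_le _ ⟨q, Rat.cast_pos.1 (hu.trans huq)⟩).trans ?_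
  rw [if_pos ((hF huq.le).trans h)]
  exact ENNReal.ofReal_le_ofReal hqa.le

lemma aemeasurable_firstBelow {F : Ω → ℝ → ℝ≥0∞} (hF : ∀ u, 0 < u → AEMeasurable (F · u) P)
    (e : ℝ≥0∞) : AEMeasurable (fun ω => firstBelow (F ω) e) P := by
  refine AEMeasurable.iInf fun ⟨q, hq⟩ => ?_
  have hstep : Measurable fun a : ℝ≥0∞ => if a ≤ e then ENNReal.ofReal q else ∞ :=
    Measurable.ite measurableSet_Iic measurable_const measurable_const
  exact hstep.comp_aemeasurable (hF q (Rat.cast_pos.2 hq))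

end FirstBelow

section SupNorm

variable {Ω : Type*} [MeasurableSpace Ω] {P : Measure Ω} {d m p q : ℕ} {𝒳 : Set (E d)}
  {φ : E d → E m} {M : ℕ → ℕ} {ε : ℝ}

lemma incrementBound_of_enorm_sub_le {g : E d → E m} {S : ℝ≥0∞} (hε : 0 < ε)
    (h : ∀ t ∈ 𝒳, ‖g t - φ t‖ₑ ≤ S) : IncrementBound 𝒳 φ g ε (ENNReal.ofReal (2 / ε) * S) := by
  intro s hs t ht T hT _
  have hT0 : 0 < T := ENNReal.ofReal_pos.1 (zero_le.trans_lt hT)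
  have herror : ∀ t ∈ 𝒳, ‖g t - φ t‖ ≤ ε / 2 * T := fun t ht => by
    have hle : ENNReal.ofReal (2 / ε * ‖g t - φ t‖) ≤ ENNReal.ofReal T := by
      rw [ENNReal.ofReal_mul (by positivity), ofReal_norm]
      exact (mul_le_mul_right (h t ht) _).trans hT.le
    rw [ENNReal.ofReal_le_ofReal_iff hT0.le, div_mul_eq_mul_div, div_le_iff₀ hε] at hle
    linarith
  linarith [norm_sub_le (g s - φ s) (g t - φ t), herror s hs, herror t ht]

lemma errorControl_of_vanishesInLp_mul_pow {g : ℕ → Ω → E d → E m} {S : ℕ → Ω → ℝ≥0∞}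
    (hm : m ≠ 0) (hqm : q ≤ m) (hS : ∀ N, AEMeasurable (S N) P)
    (hlim : VanishesInLp (fun _ => P) p fun N ω => (N / M N) * S N ω ^ q)
    (h : ∀ N, ∀ᵐ ω ∂P, ∀ t ∈ 𝒳, ‖g N ω t - φ t‖ₑ ≤ S N ω) (hε : 0 < ε) :
    ErrorControl P M 𝒳 φ g p ε
      (fun N ω => ENNReal.ofReal (2 / ε) * S N ω ^ ((q : ℝ) / m)) S where
  enorm_sub_le := h
  vanishesInLp_threshold := by
    have hpow : ∀ N ω, (N / M N) * (ENNReal.ofReal (2 / ε) * S N ω ^ ((q : ℝ) / m)) ^ m =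
        ENNReal.ofReal (2 / ε) ^ m * ((N / M N) * S N ω ^ q) := fun N ω => by
      rw [mul_pow, ← ENNReal.rpow_mul_natCast, div_mul_cancel₀ _ (Nat.cast_ne_zero.2 hm),
        ENNReal.rpow_natCast, mul_left_comm]
    simpa only [hpow] using hlim.const_mul (c := ENNReal.ofReal (2 / ε) ^ m) (by finiteness)
  vanishesInLp_indicator e he := by
    have he0 : ENNReal.ofReal e ^ q ≠ 0 := pow_ne_zero _ (ENNReal.ofReal_pos.2 he).ne'
    refine (hlim.const_mul (c := (ENNReal.ofReal e ^ q)⁻¹) ?_).mono (fun N => ?_)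
      (Eventually.of_forall fun N => ae_of_all _ fun ω => ?_)
    · exact ENNReal.inv_ne_top.2 he0
    · exact (aemeasurable_one.indicator₀
        (nullMeasurableSet_lt aemeasurable_const (hS N))).const_mul _
    · rw [mul_left_comm, mul_comm _ (S N ω ^ q), ← div_eq_mul_inv]
      refine mul_le_mul_right (Set.indicator_apply_le' (fun hω => ?_) fun _ => zero_le) _
      rw [Pi.one_apply, ENNReal.le_div_iff_mul_le (.inl he0) (.inl (by finiteness)), one_mul]
      exact pow_le_pow_left₀ zero_le (le_of_lt hω) q
  incrementBound N := by
    filter_upwards [h N] with ω hω hS1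
    refine incrementBound_of_enorm_sub_le hε fun t ht => (hω t ht).trans ?_
    calc S N ω = S N ω ^ (1 : ℝ) := (ENNReal.rpow_one _).symm
      _ ≤ S N ω ^ ((q : ℝ) / m) := ENNReal.rpow_le_rpow_of_exponent_ge hS1
        (div_le_one_of_le₀ (Nat.cast_le.2 hqm) (Nat.cast_nonneg m))

end SupNorm

section Replacement

variable {d m n k p : ℕ} {𝒳 𝒵 : Set (E d)} {φ : E d → E m} {x : E d}
  {ψ : TransformEstimator d m n k} {xs : Fin n → E d} {z : ℕ → E d}

lemma replaceFirst_self (z : ℕ → E d) :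
    replaceFirst p (fun j : Fin k => z j) (fun i : Fin p => z i) = fun j : Fin k => z j := by
  ext1 j
  unfold replaceFirst
  split_ifs <;> rfl

lemma enorm_sub_le_supDist {g : E d → E m} {t : E d} (ht : t ∈ 𝒳) :
    ‖g t - φ t‖ₑ ≤ supDist 𝒳 g φ :=
  le_iSup₂ (f := fun t (_ : t ∈ 𝒳) => ‖g t - φ t‖ₑ) t ht

lemma supDist_pow_le_replacedSupPow (hz : ∀ j, z j ∈ 𝒵) (r : ℕ) :
    supDist 𝒳 (ψ xs (fun j => z j) x) φ ^ r ≤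
      replacedSupPow 𝒳 𝒵 φ ψ x p r xs (fun j => z j) := by
  have hle := le_iSup₂ (f := fun (y : Fin p → E d) (_ : y ∈ {y : Fin p → E d | ∀ i, y i ∈ 𝒵}) =>
    supDist 𝒳 (ψ xs (replaceFirst p (fun j : Fin k => z j) y) x) φ ^ r)
    (fun i => z i) (fun i => hz i)
  rwa [replaceFirst_self] at hle

lemma replacedModulus_antitone {zs : Fin k → E d} :
    Antitone fun u => replacedModulus 𝒳 𝒵 φ ψ x p u xs zs := fun _ _ huv =>
  iSup_mono fun _ => iSup_mono' fun h => ⟨huv.trans h, le_rfl⟩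

lemma ofReal_inv_mul_enorm_sub_le_replacedModulus (hz : ∀ j, z j ∈ 𝒵) {u δ : ℝ} (hu : u ≤ δ)
    {s t : E d} (hs : s ∈ 𝒳) (ht : t ∈ 𝒳) (hst : ‖φ s - φ t‖ ≤ δ) :
    ENNReal.ofReal δ⁻¹ *
      ‖(ψ xs (fun j => z j) x s - φ s) - (ψ xs (fun j => z j) x t - φ t)‖ₑ ≤
        replacedModulus 𝒳 𝒵 φ ψ x p u xs (fun j => z j) := by
  refine le_iSup₂_of_le δ hu (mul_le_mul_right ?_ _)
  refine le_iSup₂_of_le s hs (le_iSup₂_of_le t ht (le_iSup_of_le hst ?_))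
  refine le_iSup₂_of_le (fun i : Fin p => z i) (fun i => hz i) ?_
  rw [replaceFirst_self]

lemma incrementBound_firstBelow_replacedModulus (hz : ∀ j, z j ∈ 𝒵) {ε : ℝ} (hε : 0 ≤ ε) :
    IncrementBound 𝒳 φ (ψ xs (fun j => z j) x) ε
      (firstBelow (fun u => replacedModulus 𝒳 𝒵 φ ψ x p u xs (fun j => z j))
        (ENNReal.ofReal ε)) := by
  intro s hs t ht T hT hst
  obtain ⟨u, hu0, huT, hu⟩ := exists_le_of_firstBelow_lt hT
  have hT0 : 0 < T := hu0.trans_le huT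
  have hle := (ofReal_inv_mul_enorm_sub_le_replacedModulus hz huT hs ht hst).trans hu
  rwa [← ofReal_norm, ← ENNReal.ofReal_mul (by positivity), ENNReal.ofReal_le_ofReal_iff hε,
    inv_mul_le_iff₀ hT0, mul_comm] at hle

end Replacement

section Conditions

variable {Ω : Type*} [MeasurableSpace Ω] {P : Measure Ω} {d m p : ℕ} {X Z : ℕ → Ω → E d}
  {𝒳 𝒵 : Set (E d)} {φ : E d → E m} {x : E d} {M N₁ : ℕ → ℕ} {ε : ℝ}
  {φhat : ∀ N : ℕ, TransformEstimator d m N (N₁ N)}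

lemma measurable_sample (hX : ∀ i, Measurable (X i)) (hZ : ∀ j, Measurable (Z j)) (N k : ℕ) :
    Measurable (sample X Z N k) :=
  (measurable_pi_lambda _ fun i : Fin N => hX i).prodMk
    (measurable_pi_lambda _ fun j : Fin k => hZ j)

lemma lintegral_const_mul_indicator_pow (hp : p ≠ 0) {A : Set Ω} (hA : NullMeasurableSet A P)
    (c : ℝ≥0∞) : ∫⁻ ω, (c * A.indicator 1 ω) ^ p ∂P = c ^ p * P A := by
  have hpow : ∀ ω, (c * A.indicator 1 ω) ^ p = A.indicator (fun _ => c ^ p) ω := fun ω => by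
    by_cases hω : ω ∈ A <;> simp [hω, hp]
  simp_rw [hpow]
  exact lintegral_indicator_const₀ hA _

lemma vanishesInLp_mul_pow_of_measure_lt_le (hm : m ≠ 0) (hp : p ≠ 0) {D : ℕ → Ω → ℝ≥0∞}
    (hD : ∀ N, AEMeasurable (D N) P) {T : ℕ → ℝ → ℝ≥0∞}
    (hT : ∀ N, ∀ u : ℝ, 0 < u → P {ω | ENNReal.ofReal u < D N ω} ≤ T N u) {c : ℕ → ℝ≥0∞}
    (hlim : Tendsto (fun N => c N ^ p * ∫⁻ u in Set.Ioi (0 : ℝ),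
      ENNReal.ofReal (u ^ (p - 1)) * T N (u ^ (1 / (m : ℝ)))) atTop (𝓝 0)) :
    VanishesInLp (fun _ => P) p fun N ω => c N * D N ω ^ m := by
  have hbound := ENNReal.Tendsto.const_mul hlim (Or.inr (ENNReal.natCast_ne_top p))
  rw [mul_zero] at hbound
  refine ⟨fun N => ((hD N).pow_const m).const_mul _, tendsto_of_tendsto_of_tendsto_of_le_of_le
    tendsto_const_nhds hbound (fun _ => zero_le) fun N => ?_⟩
  simp_rw [mul_pow]
  rw [lintegral_const_mul'' _ (((hD N).pow_const m).pow_const p), mul_left_comm]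
  exact mul_le_mul_right (lintegral_pow_le_of_measure_lt_le hm hp (hD N) (hT N)) _

lemma SupNormCondition.exists_errorControl (hm : m ≠ 0) (hp : p ≠ 0) (hX : ∀ i, Measurable (X i))
    (hZ : ∀ j, Measurable (Z j)) (hZ𝒵 : ∀ᵐ ω ∂P, ∀ j, Z j ω ∈ 𝒵)
    (h : SupNormCondition P X Z M N₁ 𝒳 𝒵 φ φhat p x) (hε : 0 < ε) :
    ∃ D S : ℕ → Ω → ℝ≥0∞, ErrorControl P M 𝒳 φ
      (fun N ω => φhat N (fun i => X i ω) (fun j => Z j ω) x) p ε D S := by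
  obtain ⟨q, hq, hqm, hmeas, hlim⟩ := h
  have hpq : p * q ≠ 0 := mul_ne_zero hp (Nat.one_le_iff_ne_zero.1 hq)
  let S : ℕ → Ω → ℝ≥0∞ := fun N ω => (replacedSupPow 𝒳 𝒵 φ (φhat N) x p (p * q)
    (sample X Z N (N₁ N) ω).1 (sample X Z N (N₁ N) ω).2) ^ ((p * q : ℕ) : ℝ)⁻¹
  have hS : ∀ N, AEMeasurable (S N) P := fun N =>
    ((hmeas N).comp_measurable (measurable_sample hX hZ N (N₁ N))).pow_const _
  have hSlim : VanishesInLp (fun _ => P) p fun N ω => (N / M N) * S N ω ^ q := by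
    refine ⟨fun N => ((hS N).pow_const q).const_mul _, hlim.congr fun N => ?_⟩
    simp_rw [mul_pow, ← pow_mul, mul_comm q p, S, ENNReal.rpow_inv_natCast_pow hpq]
  refine ⟨_, S, errorControl_of_vanishesInLp_mul_pow hm hqm hS hSlim (fun N => ?_) hε⟩
  filter_upwards [hZ𝒵] with ω hω t ht
  refine (enorm_sub_le_supDist ht).trans ?_
  rw [← ENNReal.pow_le_pow_left_iff hpq, ENNReal.rpow_inv_natCast_pow hpq]
  exact supDist_pow_le_replacedSupPow hω (p * q)

lemma ModulusCondition.exists_errorControl (hm : m ≠ 0) (hp : p ≠ 0) (hX : ∀ i, Measurable (X i))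
    (hZ : ∀ j, Measurable (Z j)) (hZ𝒵 : ∀ᵐ ω ∂P, ∀ j, Z j ω ∈ 𝒵)
    (h : ModulusCondition P X Z M N₁ 𝒳 𝒵 φ φhat p x) (hε : 0 < ε) :
    ∃ D S : ℕ → Ω → ℝ≥0∞, ErrorControl P M 𝒳 φ
      (fun N ω => φhat N (fun i => X i ω) (fun j => Z j ω) x) p ε D S := by
  obtain ⟨hmeas, hcond⟩ := h
  let D : ℕ → Ω → ℝ≥0∞ := fun N ω => firstBelow (fun u => replacedModulus 𝒳 𝒵 φ (φhat N) x p u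
    (sample X Z N (N₁ N) ω).1 (sample X Z N (N₁ N) ω).2) (ENNReal.ofReal ε)
  let S : ℕ → Ω → ℝ≥0∞ := fun N ω => supDist 𝒳 (φhat N (sample X Z N (N₁ N) ω).1
    (sample X Z N (N₁ N) ω).2 x) φ
  have hsample := fun N => measurable_sample hX hZ N (N₁ N)
  have hD : ∀ N, AEMeasurable (D N) P := fun N =>
    aemeasurable_firstBelow (fun u hu => ((hmeas N).1 u hu).comp_measurable (hsample N)) _
  have hS : ∀ N, AEMeasurable (S N) P := fun N => (hmeas N).2.comp_measurable (hsample N)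
  refine ⟨D, S, ⟨?_, fun e he => ?_, fun N => ?_, fun N => ?_⟩⟩
  · obtain ⟨T, hT, hTlim, -⟩ := hcond ε hε
    exact vanishesInLp_mul_pow_of_measure_lt_le hm hp hD
      (fun N u hu => (measure_mono fun ω hω => lt_of_not_ge fun hle =>
        hω.not_ge (firstBelow_le replacedModulus_antitone hu hle)).trans (hT N u hu))
      (hTlim p (Nat.one_le_iff_ne_zero.2 hp) le_rfl)
  · obtain ⟨-, -, -, htail⟩ := hcond e he
    have hmeasSet : ∀ N, NullMeasurableSet {ω | ENNReal.ofReal e < S N ω} P := fun N =>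
      nullMeasurableSet_lt aemeasurable_const (hS N)
    exact ⟨fun N => (aemeasurable_one.indicator₀ (hmeasSet N)).const_mul _,
      htail.congr fun N => (lintegral_const_mul_indicator_pow hp (hmeasSet N) _).symm⟩
  · filter_upwards [hZ𝒵] with ω hω _
    exact incrementBound_firstBelow_replacedModulus hω hε.le
  · exact ae_of_all _ fun ω t ht => enorm_sub_le_supDist ht

end Conditions

section TwoSample

variable {Ω : Type*} [MeasurableSpace Ω] {P : Measure Ω} {d m : ℕ} {X Z : ℕ → Ω → E d}
  {𝒳 𝒵 : Set (E d)} {φ : E d → E m}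

lemma measurePreserving_prodMk_of_iIndepFun {α : Type*} [MeasurableSpace α]
    [IsProbabilityMeasure P] {U V : ℕ → Ω → α} {ν₀ ν₁ : Measure α}
    (hU : ∀ i, MeasurePreserving (U i) P ν₀) (hV : ∀ j, MeasurePreserving (V j) P ν₁)
    (hindep : iIndepFun (Sum.elim U V) P) (N k : ℕ) :
    MeasurePreserving (fun ω => ((fun i : Fin N => U i ω), fun j : Fin k => V j ω)) P
      ((Measure.pi fun _ => ν₀).prod (Measure.pi fun _ => ν₁)) := by
  let W : Fin N ⊕ Fin k → Ω → α := fun l => Sum.elim U V (Sum.map Fin.val Fin.val l)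
  have hW : ∀ l, Measurable (W l) :=
    Sum.forall.2 ⟨fun i => (hU i).measurable, fun j => (hV j).measurable⟩
  have : ∀ l, IsProbabilityMeasure (P.map (W l)) := fun l =>
    Measure.isProbabilityMeasure_map (hW l).aemeasurable
  have hjoint : MeasurePreserving (fun ω l => W l ω) P (Measure.pi fun l => P.map (W l)) :=
    ⟨measurable_pi_lambda _ hW, (iIndepFun_iff_map_fun_eq_pi_map fun l => (hW l).aemeasurable).1
      (hindep.precomp (Fin.val_injective.sumMap Fin.val_injective))⟩
  have hsplit := (measurePreserving_sumPiEquivProdPi fun l => P.map (W l)).comp hjoint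
  have hlaw₀ : ∀ i : Fin N, P.map (W (Sum.inl i)) = ν₀ := fun i => (hU i).map_eq
  have hlaw₁ : ∀ j : Fin k, P.map (W (Sum.inr j)) = ν₁ := fun j => (hV j).map_eq
  simp_rw [hlaw₀, hlaw₁] at hsplit
  exact hsplit

lemma isTwoSample_of_iIndepFun [IsProbabilityMeasure P] {ν₀ ν₁ : Measure (E m)}
    (hX : ∀ i, Measurable (X i)) (hZ : ∀ j, Measurable (Z j)) (hφ : Measurable φ)
    (hindep : iIndepFun (Sum.elim X Z) P) (hν₀ : ∀ i, P.map (fun ω => φ (X i ω)) = ν₀)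
    (hν₁ : ∀ j, P.map (fun ω => φ (Z j ω)) = ν₁) (h𝒵𝒳 : 𝒵 ⊆ 𝒳)
    (hX𝒳 : ∀ i, ∀ᵐ ω ∂P, X i ω ∈ 𝒳) (hZ𝒵 : ∀ j, ∀ᵐ ω ∂P, Z j ω ∈ 𝒵) :
    IsTwoSample P X Z 𝒳 𝒵 φ ν₀ ν₁ := by
  have hindepφ : iIndepFun (Sum.elim (fun i ω => φ (X i ω)) fun j ω => φ (Z j ω)) P := by
    convert hindep.comp (fun _ => φ) fun _ => hφ using 1
    exact funext (Sum.forall.2 ⟨fun _ => rfl, fun _ => rfl⟩)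
  exact ⟨measurePreserving_prodMk_of_iIndepFun (fun i => ⟨hφ.comp (hX i), hν₀ i⟩)
    (fun j => ⟨hφ.comp (hZ j), hν₁ j⟩) hindepφ, h𝒵𝒳, ae_all_iff.2 hX𝒳, ae_all_iff.2 hZ𝒵⟩

lemma measurable_ratioEstimate (hX : ∀ i, Measurable (X i)) (hZ : ∀ j, Measurable (Z j))
    (h𝒵 : MeasurableSet 𝒵) {N k : ℕ} (M : ℕ) {g : Ω → E d → E m}
    (hg : Measurable fun a : Ω × E d => g a.1 a.2) (x : E d) :
    Measurable fun ω =>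
      ratioEstimate 𝒵 M (fun i : Fin N => X i ω) (fun j : Fin k => Z j ω) (g ω) x := by
  have heval : ∀ {Y : Ω → E d}, Measurable Y → Measurable fun ω => g ω (Y ω) := fun hY =>
    hg.comp (measurable_id.prodMk hY)
  have hcatch : ∀ j, MeasurableSet
      {ω | Z j ω ∈ catchment 𝒵 M (fun i : Fin N => X i ω) (g ω) x} := fun j =>
    (hZ j h𝒵).inter (measurableSet_le ((heval measurable_const).sub (heval (hZ j))).norm
      (measurable_orderStat.comp (measurable_pi_lambda _ fun i =>
        ((heval (hX i)).sub (heval (hZ j))).norm)))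
  unfold ratioEstimate matchCount
  refine ((Finset.measurable_sum _ fun j _ => ?_).div_const _).const_mul _
  exact Measurable.indicator (measurable_const (a := (1 : ℝ))) (hcatch j)

lemma integrable_abs_ratioEstimate_sub_pow [IsFiniteMeasure P] {N k M : ℕ} {g : Ω → E d → E m}
    {x : E d} (hmeas : Measurable fun ω =>
      ratioEstimate 𝒵 M (fun i : Fin N => X i ω) (fun j : Fin k => Z j ω) (g ω) x)
    (r : ℝ) (p : ℕ) :
    Integrable (fun ω => |ratioEstimate 𝒵 M (fun i : Fin N => X i ω)
      (fun j : Fin k => Z j ω) (g ω) x - r| ^ p) P := by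
  refine Integrable.of_bound (((hmeas.sub_const r).abs.pow_const p).aestronglyMeasurable)
    ((N / M + |r|) ^ p) (ae_of_all _ fun ω => ?_)
  rw [Real.norm_of_nonneg (by positivity)]
  gcongr
  refine (abs_sub _ _).trans (add_le_add_left ?_ _)
  rw [abs_of_nonneg ratioEstimate_nonneg]
  exact ratioEstimate_le

lemma tendsto_integral_abs_pow_of_tendsto_lintegral {p : ℕ} {F : ℕ → Ω → ℝ}
    (hF : ∀ N, AEStronglyMeasurable (fun ω => |F N ω| ^ p) P)
    (h : Tendsto (fun N => ∫⁻ ω, ENNReal.ofReal |F N ω| ^ p ∂P) atTop (𝓝 0)) :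
    Tendsto (fun N => ∫ ω, |F N ω| ^ p ∂P) atTop (𝓝 0) := by
  refine ((ENNReal.tendsto_toReal ENNReal.zero_ne_top).comp h).congr fun N => ?_
  rw [integral_eq_lintegral_of_nonneg_ae (ae_of_all _ fun ω => by positivity) (hF N)]
  simp only [Function.comp_apply, ENNReal.ofReal_pow (abs_nonneg _)]

lemma ae_mem_support_of_identDistrib {Y Y' : Ω → E d} (h : IdentDistrib Y Y' P P) :
    ∀ᵐ ω ∂P, Y ω ∈ (P.map Y').support :=
  ae_of_ae_map h.aemeasurable_fst (h.map_eq ▸ Measure.support_mem_ae)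

lemma tendsto_div_of_tendsto_mul_log_div {M : ℕ → ℕ}
    (h : Tendsto (fun N : ℕ => (M N : ℝ) * Real.log N / N) atTop (𝓝 0)) :
    Tendsto (fun N : ℕ => (M N : ℝ) / N) atTop (𝓝 0) := by
  refine tendsto_of_tendsto_of_tendsto_of_le_of_le' tendsto_const_nhds h
    (Eventually.of_forall fun N => by positivity) ?_
  filter_upwards [(Real.tendsto_log_atTop.comp
    tendsto_natCast_atTop_atTop).eventually_ge_atTop 1] with N hN
  gcongr
  exact le_mul_of_one_le_right (by positivity) hN

end TwoSample

end DensityRatio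

theorem mainTheorem10_general
    {Ω : Type*} [MeasurableSpace Ω] (P : Measure Ω) [IsProbabilityMeasure P]
    (d m : ℕ) (hm : 1 ≤ m)
    (X Z : ℕ → Ω → DensityRatio.E d) (hX : ∀ i, Measurable (X i)) (hZ : ∀ j, Measurable (Z j))
    (hindep : iIndepFun (Sum.elim X Z) P)
    (𝒳 𝒵 : Set (DensityRatio.E d)) (h𝒵 : MeasurableSet 𝒵) (h𝒵𝒳 : 𝒵 ⊆ 𝒳)
    (hX𝒳 : ∀ i, ∀ᵐ ω ∂P, X i ω ∈ 𝒳) (hZ𝒵 : ∀ j, ∀ᵐ ω ∂P, Z j ω ∈ 𝒵)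
    (φ : DensityRatio.E d → DensityRatio.E m) (hφ : Measurable φ)
    (f₀ f₁ r : DensityRatio.E m → ℝ) (hf₁_nonneg : ∀ y, 0 ≤ f₁ y)
    (hν₀ : ∀ i, P.map (fun ω => φ (X i ω)) = volume.withDensity fun y => ENNReal.ofReal (f₀ y))
    (hν₁ : ∀ j, P.map (fun ω => φ (Z j ω)) = volume.withDensity fun y => ENNReal.ofReal (f₁ y))
    (hr : ∀ y, r y = f₁ y / f₀ y)
    (M N₁ : ℕ → ℕ) (hM_div : Tendsto (fun N : ℕ => (M N : ℝ) / N) atTop (𝓝 0))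
    (hMN₁ : Tendsto (fun N : ℕ => (M N : ℝ) * (N₁ N : ℝ) / N) atTop atTop)
    (hM : Tendsto M atTop atTop)
    (φhat : ∀ N : ℕ, DensityRatio.TransformEstimator d m N (N₁ N))
    (hφhat : ∀ N x, Measurable
      (fun s : ((Fin N → DensityRatio.E d) × (Fin (N₁ N) → DensityRatio.E d)) ×
        DensityRatio.E d => φhat N s.1.1 s.1.2 x s.2))
    (p : ℕ) (hp : 0 < p) :
    ∀ x ∈ 𝒳,
      (DensityRatio.SupNormCondition P X Z M N₁ 𝒳 𝒵 φ φhat p x ∨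
        DensityRatio.ModulusCondition P X Z M N₁ 𝒳 𝒵 φ φhat p x) →
      0 < f₀ (φ x) → ContinuousAt f₀ (φ x) → ContinuousAt f₁ (φ x) →
      (∀ N : ℕ, Integrable (fun ω =>
        |DensityRatio.ratioEstimate 𝒵 (M N) (fun i : Fin N => X i ω)
            (fun j : Fin (N₁ N) => Z j ω)
            (φhat N (fun i => X i ω) (fun j => Z j ω) x) x - r (φ x)| ^ p) P) ∧
      Tendsto (fun N : ℕ => ∫ ω,
        |DensityRatio.ratioEstimate 𝒵 (M N) (fun i : Fin N => X i ω)
            (fun j : Fin (N₁ N) => Z j ω)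
            (φhat N (fun i => X i ω) (fun j => Z j ω) x) x - r (φ x)| ^ p ∂P)
        atTop (𝓝 0) := by
  open DensityRatio in
  intro x hx hcond hpos hc₀ hc₁
  have hm0 : m ≠ 0 := Nat.one_le_iff_ne_zero.1 hm
  have hprob₀ : IsProbabilityMeasure (volume.withDensity fun y => ENNReal.ofReal (f₀ y)) :=
    hν₀ 0 ▸ Measure.isProbabilityMeasure_map (hφ.comp (hX 0)).aemeasurable
  have hprob₁ : IsProbabilityMeasure (volume.withDensity fun y => ENNReal.ofReal (f₁ y)) :=
    hν₁ 0 ▸ Measure.isProbabilityMeasure_map (hφ.comp (hZ 0)).aemeasurable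
  have hXZ : IsTwoSample P X Z 𝒳 𝒵 φ _ _ :=
    isTwoSample_of_iIndepFun hX hZ hφ hindep hν₀ hν₁ h𝒵𝒳 hX𝒳 hZ𝒵
  have hmeas := fun N => measurable_ratioEstimate hX hZ h𝒵 (N := N) (k := N₁ N) (M N)
    (g := fun ω => φhat N (fun i => X i ω) (fun j => Z j ω) x)
    ((hφhat N x).comp ((measurable_sample hX hZ N (N₁ N)).prodMap measurable_id)) x
  have hint := fun N => integrable_abs_ratioEstimate_sub_pow (P := P) (hmeas N) (r (φ x)) p
  refine ⟨hint, tendsto_integral_abs_pow_of_tendsto_lintegral (fun N => (hint N).1) ?_⟩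
  rw [hr]
  exact tendsto_lintegral_abs_sampleRatioEstimate_sub_pow ⟨hM_div, hMN₁, hM⟩ hp.ne' hm0 hpos
    (hf₁_nonneg _) hc₀ hc₁ hXZ hx (fun ε hε => hcond.elim
      (fun h => h.exists_errorControl hm0 hp.ne' hX hZ hXZ.ae_mem_right hε)
      fun h => h.exists_errorControl hm0 hp.ne' hX hZ hXZ.ae_mem_right hε) hmeas

theorem mainTheorem10
    {Ω : Type*} [MeasurableSpace Ω] (P : Measure Ω) [IsProbabilityMeasure P]
    (d m : ℕ) (hm : 1 ≤ m)
    -- the two random vectors, and their samples: independent copies, mutually independent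
    (X Z : Ω → DensityRatio.E d) (hX : Measurable X) (hZ : Measurable Z)
    (Xs Zs : ℕ → Ω → DensityRatio.E d)
    (hXs : ∀ i, Measurable (Xs i)) (hZs : ∀ j, Measurable (Zs j))
    (hXs_copy : ∀ i, IdentDistrib (Xs i) X P P) (hZs_copy : ∀ j, IdentDistrib (Zs j) Z P P)
    (hindep : iIndepFun (Sum.elim Xs Zs) P)
    -- the supports of the two random vectors
    (𝒳 𝒵 : Set (DensityRatio.E d))
    (h𝒳 : 𝒳 = (P.map X).support) (h𝒵 : 𝒵 = (P.map Z).support) (h𝒵𝒳 : 𝒵 ⊆ 𝒳)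
    -- the transformation, the densities of the transformed vectors, and their ratio
    (φ : DensityRatio.E d → DensityRatio.E m) (hφ : Measurable φ)
    (f₀ f₁ r : DensityRatio.E m → ℝ)
    (hf₀ : Measurable f₀) (hf₁ : Measurable f₁)
    (hf₀_nonneg : ∀ y, 0 ≤ f₀ y) (hf₁_nonneg : ∀ y, 0 ≤ f₁ y)
    (hν₀ : P.map (fun ω => φ (X ω)) = volume.withDensity (fun y => ENNReal.ofReal (f₀ y)))
    (hν₁ : P.map (fun ω => φ (Z ω)) = volume.withDensity (fun y => ENNReal.ofReal (f₁ y)))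
    (hac : P.map (fun ω => φ (Z ω)) ≪ P.map (fun ω => φ (X ω)))
    (hr : ∀ y, r y = f₁ y / f₀ y)
    -- the number of matches and the second sample size, as functions of the first sample size
    (M N₁ : ℕ → ℕ)
    (hM_log : Tendsto (fun N : ℕ => (M N : ℝ) * Real.log N / N) atTop (𝓝 0))
    (hMN₁ : Tendsto (fun N : ℕ => (M N : ℝ) * (N₁ N : ℝ) / N) atTop atTop)
    (hM : Tendsto M atTop atTop)
    -- the estimators of the transformation
    (φhat : ∀ N : ℕ, DensityRatio.TransformEstimator d m N (N₁ N))
    (hφhat : ∀ N x, Measurable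
      (fun s : ((Fin N → DensityRatio.E d) × (Fin (N₁ N) → DensityRatio.E d)) ×
        DensityRatio.E d => φhat N s.1.1 s.1.2 x s.2))
    (p : ℕ) (hp : 0 < p) (hp_even : Even p) :
    ∀ x ∈ 𝒳,
      (DensityRatio.SupNormCondition P Xs Zs M N₁ 𝒳 𝒵 φ φhat p x ∨
        DensityRatio.ModulusCondition P Xs Zs M N₁ 𝒳 𝒵 φ φhat p x) →
      0 < f₀ (φ x) → ContinuousAt f₀ (φ x) → ContinuousAt f₁ (φ x) →
      (∀ N : ℕ, Integrable (fun ω =>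
        |DensityRatio.ratioEstimate 𝒵 (M N) (fun i : Fin N => Xs i ω)
            (fun j : Fin (N₁ N) => Zs j ω)
            (φhat N (fun i => Xs i ω) (fun j => Zs j ω) x) x - r (φ x)| ^ p) P) ∧
      Tendsto (fun N : ℕ => ∫ ω,
        |DensityRatio.ratioEstimate 𝒵 (M N) (fun i : Fin N => Xs i ω)
            (fun j : Fin (N₁ N) => Zs j ω)
            (φhat N (fun i => Xs i ω) (fun j => Zs j ω) x) x - r (φ x)| ^ p ∂P)
        atTop (𝓝 0) := by
  open DensityRatio in
  refine mainTheorem10_general P d m hm Xs Zs hXs hZs hindep 𝒳 𝒵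
    (h𝒵 ▸ Measure.isClosed_support.measurableSet) h𝒵𝒳
    (fun i => h𝒳 ▸ ae_mem_support_of_identDistrib (hXs_copy i))
    (fun j => h𝒵 ▸ ae_mem_support_of_identDistrib (hZs_copy j)) φ hφ f₀ f₁ r hf₁_nonneg
    (fun i => ((hXs_copy i).comp hφ).map_eq.trans hν₀)
    (fun j => ((hZs_copy j).comp hφ).map_eq.trans hν₁) hr M N₁
    (tendsto_div_of_tendsto_mul_log_div hM_log) hMN₁ hM φhat hφhat p hp
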